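/- **Setting.** Let $F_1,\dots,F_L$ be probability distributions on $\mathbb R$ (the input distributions). $F_\ell$ belongs to a known family, in which it is uniquely determined by its first $h_\ell$ moments, it has finite moments up to order $4h_\ell$, and it is not concentrated on $h_\ell$ or fewer points. Put $d=\sum_\ell h_\ell$ and let $x_c\in\mathbb R^d$ be the vector of the moments $\mathrm E_{F_\ell}[Z^a]$, $1\le a\le h_\ell$, $1\le \ell\le L$. For every $\ell$ the data $Z_{\ell,1},Z_{\ell,2},\dots$ are i.i.d. with law $F_\ell$, and the $L$ sequences are independent. For each $m\in\mathbb N$, $m_\ell=m_\ell(m)$ observations of the $\ell$-th sequence are used, with $m_\ell/m\to1$ as $m\to\infty$ for every $\ell$; $X_m\in\mathbb R^d$ is the vector of the sample moments $m_\ell^{-1}\sum_{j\le m_\ell}Z_{\ell,j}^a$. For $b=1,2,\dots$, $\widehat X_m^{(b)}$ is the vector of sample moments of a bootstrap resample: $m_\ell$ independent draws with replacement from $Z_{\ell,1},\dots,Z_{\ell,m_\ell}$ for each $\ell$, independently over $\ell$ and $b$. Let $M$ be a stationary, separable Gaussian process on $\mathbb R^d$ with mean $\beta_0$, variance $\tau^2>0$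 and continuous correlation function $r$, $\mathrm{Cov}[M(x),M(x')]=\tau^2r(x-x')$, such that for some $c,\gamma>0$ and $0<\delta<1$, $1-r(u)\le c/|\log\|u\||^{1+\gamma}$ whenever $0<\|u\|\le\delta$. The first three derivatives of $r$ exist and the third one is bounded. The simulation outputs are $Y_j(x)=M(x)+\epsilon_j(x)$, where $\epsilon_1(x),\epsilon_2(x),\dots$ are i.i.d. $N(0,\sigma_\epsilon^2(x))$, independently for different $x$. The data, the noise, $M$ and the bootstrap are mutually independent. Fix distinct design points $x_1,\dots,x_k\in\mathbb R^d$ and replication numbers $n_1,\dots,n_k\ge1$; let $\bar Y$ be the vector of the means $\bar Y(x_i)=n_i^{-1}\sum_{j\le n_i}Y_j(x_i)$, $\Sigma=(\tau^2r(x_i-x_j))_{i,j}$ and $C=\mathrm{diag}(\sigma_\epsilon^2(x_i)/n_i)$. Assume that $\Sigma+C$ is positive definite and that the gradients $\nabla r(x_c-x_1),\dots,\nabla r(x_c-x_k)$ are not all equal. Let $$m_p(x)=\widehat\beta_0+\tau^2\bigl(r(x-x_1),\dots,r(x-x_k)\bigr)(\Sigma+C)^{-1}(\bar Y-\widehat\beta_0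 1),\qquad \widehat\beta_0=\frac{1^\top(\Sigma+C)^{-1}\bar Y}{1^\top(\Sigma+C)^{-1}1},$$ be the stochastic kriging predictor. Conditionally on $\bar Y$, that is, with $m_p$ held fixed, let $\sigma_I^2=\mathrm{Var}[m_p(X_m)]$. Let $\widehat\sigma_I^2=\frac1{B-1}\sum_{b=1}^B(\mu_b-\bar\mu)^2$ with $\mu_b=m_p(\widehat X_m^{(b)})$ and $\bar\mu=\frac1B\sum_{b=1}^B\mu_b$. **Theorem.** Let $\Lambda$ be the $d\times d$ block diagonal matrix whose $\ell$-th block is the covariance matrix of $(Z,Z^2,\dots,Z^{h_\ell})$, $Z\sim F_\ell$. Then $\Lambda$ is positive definite and is the asymptotic covariance matrix of the moment estimators: $\sqrt m\,(X_m-x_c)\to N(0,\Lambda)$ in distribution. Moreover, almost surely, $$\lim_{m\to\infty}m\,\sigma_I^2=\lim_{m\to\infty}\lim_{B\to\infty}m\,\widehat\sigma_I^2=\sigma_\mu^2,\qquad \sigma_\mu^2=\nabla m_p(x_c)^\top\Lambda\,\nabla m_p(x_c)>0,$$ where all the limits exist. -/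

import Mathlib

open MeasureTheory ProbabilityTheory Filter Topology
open scoped NNReal ENNReal Matrix

noncomputable section

namespace InputUncertainty

/-- Coordinates of the vector of moments: the pair `⟨ℓ, a⟩` stands for the moment of order `a + 1`
of the `ℓ`-th input distribution, `a < h ℓ`. -/
abbrev MomentIndex {L : ℕ} (h : Fin L → ℕ) : Type := (ℓ : Fin L) × Fin (h ℓ)

/-- The Euclidean space `ℝ^d`, `d = ∑ ℓ, h ℓ`, in which the vectors of moments live. -/
abbrev MomentSpace {L : ℕ} (h : Fin L → ℕ) : Type := EuclideanSpace ℝ (MomentIndex h)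

/-! ### Input models, moment estimators and the bootstrap -/

/-- The vector `x_c` of the true moments of the input distributions. -/
def trueMoments {L : ℕ} (h : Fin L → ℕ) (F : Fin L → Measure ℝ) : MomentSpace h :=
  WithLp.toLp 2 fun i => ∫ z, z ^ (i.2.val + 1) ∂(F i.1)

/-- The stacked vector of sample moments of samples `z ℓ 0, …, z ℓ (n ℓ - 1)`. -/
def sampleMoments {L : ℕ} (h : Fin L → ℕ) (n : Fin L → ℕ) (z : (ℓ : Fin L) → Fin (n ℓ) → ℝ) :
    MomentSpace h :=
  WithLp.toLp 2 fun i => (∑ j, z i.1 j ^ (i.2.val + 1)) / (n i.1 : ℝ)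

/-- The covariance matrix of the blocks of powers `(Z_ℓ, Z_ℓ ^ 2, …, Z_ℓ ^ (h ℓ))` of independent
variables `Z_ℓ ∼ F ℓ`. -/
def momentCov {L : ℕ} (h : Fin L → ℕ) (F : Fin L → Measure ℝ) :
    Matrix (MomentIndex h) (MomentIndex h) ℝ :=
  Matrix.of fun i j =>
    if i.1 = j.1 then
      cov[fun z : ℝ => z ^ (i.2.val + 1), fun z : ℝ => z ^ (j.2.val + 1); F i.1]
    else 0

/-- The σ-algebra generated by a family of random elements. -/
abbrev generatedBy {Ω ι : Type*} {β : ι → Type*} [∀ i, MeasurableSpace (β i)]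
    (X : (i : ι) → Ω → β i) : MeasurableSpace Ω :=
  ⨆ i, MeasurableSpace.comap (X i) inferInstance

variable {Ω : Type*} [MeasurableSpace Ω]

/-- Each input distribution `F ℓ` belongs to a known family `𝓕 ℓ`, in which it is uniquely
determined by its first `h ℓ` moments, and has finite moments up to order `4 * h ℓ`. -/
structure InputModel {L : ℕ} (h : Fin L → ℕ) (𝓕 : Fin L → Set (Measure ℝ))
    (F : Fin L → Measure ℝ) : Prop where
  isProb : ∀ ℓ, IsProbabilityMeasure (F ℓ)
  mem_family : ∀ ℓ, F ℓ ∈ 𝓕 ℓ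
  determined : ∀ ℓ, ∀ G ∈ 𝓕 ℓ,
    (∀ q ∈ Finset.Icc 1 (h ℓ), Integrable (fun z : ℝ => z ^ q) G ∧
      ∫ z, z ^ q ∂G = ∫ z, z ^ q ∂(F ℓ)) → G = F ℓ
  integrable_pow : ∀ ℓ, ∀ q ≤ 4 * h ℓ, Integrable (fun z : ℝ => z ^ q) (F ℓ)

/-- The real-world data: `Z ℓ 0, Z ℓ 1, …` are i.i.d. with law `F ℓ`, and the `L` input processes
are independent of each other. -/
structure IsInputData (P : Measure Ω) {L : ℕ} (F : Fin L → Measure ℝ)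
    (Z : Fin L → ℕ → Ω → ℝ) : Prop where
  measurable : ∀ ℓ j, Measurable (Z ℓ j)
  law : ∀ ℓ j, P.map (Z ℓ j) = F ℓ
  indep : iIndepFun (fun p : Fin L × ℕ => Z p.1 p.2) P

/-- The indices drawn by the bootstrap: for the sample sizes `N m ℓ`, the `b`-th resample from the
`ℓ`-th data set consists of the observations number `I m b ℓ 0, I m b ℓ 1, …`; all these indices
are uniformly distributed, and for every `m` they are independent of each other. -/
structure IsBootstrap (P : Measure Ω) {L : ℕ} (N : ℕ → Fin L → ℕ)
    (I : (m : ℕ) → ℕ → (ℓ : Fin L) → Fin (N m ℓ) → Ω → Fin (N m ℓ)) : Prop where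
  measurable : ∀ m b ℓ j, Measurable (I m b ℓ j)
  uniform : ∀ m b ℓ j, ∀ i : Fin (N m ℓ), P {ω | I m b ℓ j ω = i} = (N m ℓ : ℝ≥0∞)⁻¹
  indep : ∀ m, iIndepFun (fun p : ℕ × ((ℓ : Fin L) × Fin (N m ℓ)) => I m p.1 p.2.1 p.2.2) P

/-- The moment estimator `X_m` computed from the data, with `N m ℓ` observations from the `ℓ`-th
input distribution. -/
def momentEstimator {L : ℕ} (h : Fin L → ℕ) (N : ℕ → Fin L → ℕ) (Z : Fin L → ℕ → Ω → ℝ)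
    (m : ℕ) (ω : Ω) : MomentSpace h :=
  sampleMoments h (N m) fun ℓ j => Z ℓ j ω

/-- The `b`-th bootstrap moment estimator, computed from the `b`-th resample of the data. -/
def bootstrapMoments {L : ℕ} (h : Fin L → ℕ) (N : ℕ → Fin L → ℕ) (Z : Fin L → ℕ → Ω → ℝ)
    (I : (m : ℕ) → ℕ → (ℓ : Fin L) → Fin (N m ℓ) → Ω → Fin (N m ℓ))
    (m b : ℕ) (ω : Ω) : MomentSpace h :=
  sampleMoments h (N m) fun ℓ j => Z ℓ (I m b ℓ j ω) ω

/-! ### The response surface and the simulation noise -/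

variable {E : Type*} [NormedAddCommGroup E]

/-- Separability of a real process indexed by `E`, in the sense of Doob. -/
def IsSeparableProcess (P : Measure Ω) (M : E → Ω → ℝ) : Prop :=
  ∃ S : Set E, S.Countable ∧ Dense S ∧
    ∀ᵐ ω ∂P, ∀ U : Set E, IsOpen U → ∀ C : Set ℝ, IsClosed C →
      (∀ x ∈ S ∩ U, M x ω ∈ C) → ∀ x ∈ U, M x ω ∈ C

/-- `M` is a stationary, separable Gaussian process with mean `β₀`, variance `τ2 > 0` and
continuous correlation function `r`, and `1 - r` decays at a logarithmic rate at the origin. -/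
structure IsStationaryGP (P : Measure Ω) (β₀ τ2 : ℝ) (r : E → ℝ) (M : E → Ω → ℝ) : Prop where
  measurable : ∀ x, Measurable (M x)
  gaussian : IsGaussianProcess M P
  mean : ∀ x, P[M x] = β₀
  covariance : ∀ x x', cov[M x, M x'; P] = τ2 * r (x - x')
  variance_pos : 0 < τ2
  corr_zero : r 0 = 1
  corr_continuous : Continuous r
  corr_decay : ∃ c γ δ : ℝ, 0 < c ∧ 0 < γ ∧ 0 < δ ∧ δ < 1 ∧
    ∀ u : E, ‖u‖ ≤ δ → 1 - r u ≤ c / |Real.log ‖u‖| ^ (1 + γ)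
  separable : IsSeparableProcess P M

/-- The simulation noise: `ε 0 x, ε 1 x, …` (one for each replication) are i.i.d. `N(0, s2 x)` for
every `x`, and the noise at different points is independent. -/
structure IsSimulationNoise (P : Measure Ω) (s2 : E → ℝ≥0) (ε : ℕ → E → Ω → ℝ) : Prop where
  measurable : ∀ j x, Measurable (ε j x)
  law : ∀ j x, P.map (ε j x) = gaussianReal 0 (s2 x)
  indep : iIndepFun (fun p : ℕ × E => ε p.1 p.2) P

/-- The sample means `Ȳ(x_i)` of the simulation outputs `Y_j(x_i) = M(x_i) + ε_j(x_i)`,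
`j < n i`, at the design points `x_i`. -/
def outputMeans {k : ℕ} (x : Fin k → E) (n : Fin k → ℕ) (M : E → Ω → ℝ) (ε : ℕ → E → Ω → ℝ)
    (ω : Ω) : Fin k → ℝ :=
  fun i => (∑ j ∈ Finset.range (n i), (M (x i) ω + ε j (x i) ω)) / (n i : ℝ)

/-! ### Stochastic kriging -/

/-- The matrix `Σ + C`: spatial covariance of the design points plus the diagonal matrix of the
variances of the averaged simulation noise. -/
def designCov {k : ℕ} (τ2 : ℝ) (r : E → ℝ) (s2 : E → ℝ≥0) (x : Fin k → E) (n : Fin k → ℕ) :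
    Matrix (Fin k) (Fin k) ℝ :=
  Matrix.of (fun i j => τ2 * r (x i - x j)) +
    Matrix.diagonal (fun i => (s2 (x i) : ℝ) / (n i : ℝ))

/-- The generalized least squares estimator `(1ᵀ V⁻¹ 1)⁻¹ 1ᵀ V⁻¹ y` of `β₀`. -/
def glsMean {k : ℕ} (V : Matrix (Fin k) (Fin k) ℝ) (y : Fin k → ℝ) : ℝ :=
  ((1 : Fin k → ℝ) ⬝ᵥ (V⁻¹ *ᵥ (1 : Fin k → ℝ)))⁻¹ * ((1 : Fin k → ℝ) ⬝ᵥ (V⁻¹ *ᵥ y))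

/-- The stochastic kriging predictor `m_p` at `p`, for the vector `y` of sample means:
`β̂₀ + Σ(p, ·)ᵀ (Σ + C)⁻¹ (y - β̂₀ 1)`. -/
def krigingMean {k : ℕ} (τ2 : ℝ) (r : E → ℝ) (s2 : E → ℝ≥0) (x : Fin k → E) (n : Fin k → ℕ)
    (y : Fin k → ℝ) (p : E) : ℝ :=
  glsMean (designCov τ2 r s2 x n) y +
    (fun i => τ2 * r (p - x i)) ⬝ᵥ
      ((designCov τ2 r s2 x n)⁻¹ *ᵥ (fun i => y i - glsMean (designCov τ2 r s2 x n) y))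

/-! ### Variance components -/

/-- The input variance `σ_I²`: the variance of `g(X)`, for the sampling distribution of `X`. -/
def inputVariance (P : Measure Ω) (g : E → ℝ) (X : Ω → E) : ℝ :=
  Var[fun ω => g (X ω); P]

/-- The sample variance, with denominator `B - 1`, of `v 0, …, v (B - 1)`. -/
def sampleVariance (B : ℕ) (v : ℕ → ℝ) : ℝ :=
  (∑ b ∈ Finset.range B, (v b - (∑ b' ∈ Finset.range B, v b') / (B : ℝ)) ^ 2) / ((B : ℝ) - 1)

/-- The quadratic form `∇g(x)ᵀ Λ ∇g(x)`. -/
def deltaVariance {ι : Type*} [Fintype ι] (g : EuclideanSpace ℝ ι → ℝ) (Λ : Matrix ι ι ℝ)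
    (x : EuclideanSpace ℝ ι) : ℝ :=
  (gradient g x).ofLp ⬝ᵥ (Λ *ᵥ (gradient g x).ofLp)

end InputUncertainty

end

open InputUncertainty

open InputUncertainty

namespace InputUncertainty

/-! Once the outputs are fixed, the kriging predictor is a deterministic function g. It is `C²`
because `r` is, and bounded because `|r| ≤ 1`. Write g(X) as a linear function of X, plus a
constant, plus a Taylor remainder R. The linear part has variance exactly `aᵀ Cov(X) a`, of order
1/m. Boundedness of g makes |R| ≤ K‖X - x₀‖² hold on the whole space, so E R² is controlled by
fourth central moments of sample means. These are O(m⁻²), which is where moments up to order `4 * h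
ℓ` enter. By Cauchy–Schwarz, m Var[g(X)] and m times the linear variance have the same limit.

The error bound `IsMomentSample.abs_variance_comp_sub_le` holds for every sample size and sees the
law of the observations only through finitely many moments. Hence `tendsto_mul_variance_of_contDiff`
allows the law to vary with m. With the law `F` it gives the limit of the input variance. With the
data frozen and the empirical measures as laws it gives the bootstrap limit, since the strong law
makes the empirical moments converge almost surely. The inner limit in B is the strong law on the
finite set of possible resamples (`IsBootstrap.ae_tendsto_sampleVariance`).

Positivity has two sources. `momentCov_posDef`: a degenerate covariance would put some `F ℓ` on the
roots of a nonzero polynomial of degree at most `h ℓ`. `ae_dotProduct_outputMeans_ne_zero`: a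
directional derivative of the predictor is a nonzero linear functional of the nondegenerate Gaussian
vector of outputs, so it almost surely does not vanish. The asymptotic normality of the moments
follows from scalar central limit theorems via characteristic functions. -/

/-! ### Second and fourth moments of sums of independent variables. -/

lemma integrable_pow_of_memLp {Ω : Type*} [MeasurableSpace Ω] {P : Measure Ω} [IsFiniteMeasure P]
    {X : Ω → ℝ} {p : ℕ} (hX : MemLp X p P) {k : ℕ} (hk : k ≤ p) :
    Integrable (fun ω => X ω ^ k) P := by
  have h1 : MemLp X k P := hX.mono_exponent (by exact_mod_cast hk)
  refine (integrable_norm_iff (hX.aestronglyMeasurable.pow k)).1 ?_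
  simpa [norm_pow] using h1.integrable_norm_pow'

lemma sq_integral_sq_le {Ω : Type*} [MeasurableSpace Ω] {P : Measure Ω} [IsProbabilityMeasure P]
    {X : Ω → ℝ} (hX : MemLp X 4 P) :
    (∫ ω, X ω ^ 2 ∂P) ^ 2 ≤ ∫ ω, X ω ^ 4 ∂P := by
  have h4 : Integrable (fun ω => X ω ^ 4) P :=
    integrable_pow_of_memLp (p := 4) (by exact_mod_cast hX) le_rfl
  have h2 : MemLp (fun ω => X ω ^ 2) 2 P := by
    refine (memLp_two_iff_integrable_sq (hX.aestronglyMeasurable.pow 2)).2 ?_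
    simpa [← pow_mul] using h4
  have := variance_nonneg (fun ω => X ω ^ 2) P
  rw [variance_eq_sub h2] at this
  have e : ∫ ω, X ω ^ 4 ∂P = P[(fun ω => X ω ^ 2) ^ 2] :=
    integral_congr_ae (ae_of_all _ fun ω => by simp [← pow_mul])
  rw [e]
  linarith

/-- In the binomial expansion the cross terms of type (3,1) and (1,3) factor by independence and
contain a vanishing mean; only the (2,2) term survives. -/
lemma integral_add_pow_four {Ω : Type*} [MeasurableSpace Ω] {P : Measure Ω}
    [IsProbabilityMeasure P] {X Y : Ω → ℝ} (hX : MemLp X 4 P) (hY : MemLp Y 4 P)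
    (hXY : IndepFun X Y P) (hX0 : ∫ ω, X ω ∂P = 0) (hY0 : ∫ ω, Y ω ∂P = 0) :
    ∫ ω, (X ω + Y ω) ^ 4 ∂P =
      ∫ ω, X ω ^ 4 ∂P + 6 * ((∫ ω, X ω ^ 2 ∂P) * ∫ ω, Y ω ^ 2 ∂P) + ∫ ω, Y ω ^ 4 ∂P := by
  have iX : ∀ k ≤ 4, Integrable (fun ω => X ω ^ k) P := fun k hk =>
    integrable_pow_of_memLp (p := 4) (by exact_mod_cast hX) hk
  have iY : ∀ k ≤ 4, Integrable (fun ω => Y ω ^ k) P := fun k hk =>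
    integrable_pow_of_memLp (p := 4) (by exact_mod_cast hY) hk
  have ind : ∀ a b : ℕ, IndepFun (fun ω => X ω ^ a) (fun ω => Y ω ^ b) P := fun a b =>
    hXY.comp (φ := fun x : ℝ => x ^ a) (ψ := fun x : ℝ => x ^ b) (by fun_prop) (by fun_prop)
  have iXY : ∀ a ≤ 4, ∀ b ≤ 4, Integrable (fun ω => X ω ^ a * Y ω ^ b) P := fun a ha b hb =>
    (ind a b).integrable_mul (iX a ha) (iY b hb)
  have eXY : ∀ a ≤ 4, ∀ b ≤ 4, ∫ ω, X ω ^ a * Y ω ^ b ∂P =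
      (∫ ω, X ω ^ a ∂P) * ∫ ω, Y ω ^ b ∂P := fun a ha b hb =>
    (ind a b).integral_fun_mul_eq_mul_integral (iX a ha).aestronglyMeasurable
      (iY b hb).aestronglyMeasurable
  have e : ∀ ω, (X ω + Y ω) ^ 4 = X ω ^ 4 + (4 * (X ω ^ 3 * Y ω ^ 1) + (6 * (X ω ^ 2 * Y ω ^ 2)
      + (4 * (X ω ^ 1 * Y ω ^ 3) + Y ω ^ 4))) := fun ω => by ring
  have j1 := (iXY 3 (by norm_num) 1 (by norm_num)).const_mul 4
  have j2 := (iXY 2 (by norm_num) 2 (by norm_num)).const_mul 6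
  have j3 := (iXY 1 (by norm_num) 3 (by norm_num)).const_mul 4
  have j4 := iY 4 le_rfl
  have k3 : Integrable (fun ω => 4 * (X ω ^ 1 * Y ω ^ 3) + Y ω ^ 4) P := j3.add j4
  have k2 : Integrable (fun ω => 6 * (X ω ^ 2 * Y ω ^ 2) +
      (4 * (X ω ^ 1 * Y ω ^ 3) + Y ω ^ 4)) P := j2.add k3
  have k1 : Integrable (fun ω => 4 * (X ω ^ 3 * Y ω ^ 1) + (6 * (X ω ^ 2 * Y ω ^ 2) +
      (4 * (X ω ^ 1 * Y ω ^ 3) + Y ω ^ 4))) P := j1.add k2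
  simp_rw [e]
  rw [integral_add (iX 4 le_rfl) k1, integral_add j1 k2, integral_add j2 k3, integral_add j3 j4,
    integral_const_mul, integral_const_mul, integral_const_mul,
    eXY 3 (by norm_num) 1 (by norm_num), eXY 2 (by norm_num) 2 (by norm_num),
    eXY 1 (by norm_num) 3 (by norm_num)]
  simp only [pow_one, hX0, hY0]
  ring

/-- The fourth moment of a sum of independent centred variables grows at most quadratically. -/
lemma integral_sum_pow_four_le {Ω ι : Type*} [MeasurableSpace Ω] {P : Measure Ω}
    [IsProbabilityMeasure P] {Y : ι → Ω → ℝ} (hm : ∀ i, Measurable (Y i)) (hind : iIndepFun Y P)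
    (hY : ∀ i, MemLp (Y i) 4 P) (h0 : ∀ i, ∫ ω, Y i ω ∂P = 0) {c : ℝ}
    (hc : ∀ i, ∫ ω, Y i ω ^ 4 ∂P ≤ c) (s : Finset ι) :
    ∫ ω, (∑ i ∈ s, Y i ω) ^ 4 ∂P ≤ 3 * (s.card : ℝ) ^ 2 * c := by
  classical
  -- A member of the index type is needed to deduce `0 ≤ c`.
  rcases s.eq_empty_or_nonempty with rfl | ⟨i₀, -⟩
  · simp
  have hc0 : 0 ≤ c := (integral_nonneg fun ω => by positivity).trans (hc i₀)
  have hv : ∀ i, ∫ ω, Y i ω ^ 2 ∂P ≤ √c := fun i =>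
    Real.le_sqrt_of_sq_le ((sq_integral_sq_le (hY i)).trans (hc i))
  -- The (2,2) term forces the second moment into the induction. With n terms present, the fourth
  -- moment grows by at most (6n + 1)c, within 3(n + 1)² - 3n² = 6n + 3.
  suffices H : ∫ ω, (∑ i ∈ s, Y i ω) ^ 2 ∂P ≤ s.card * √c ∧
      ∫ ω, (∑ i ∈ s, Y i ω) ^ 4 ∂P ≤ 3 * (s.card : ℝ) ^ 2 * c from H.2
  induction s using Finset.induction_on with
  | empty => simp
  | insert a s ha ih =>
    have hS : MemLp (fun ω => ∑ i ∈ s, Y i ω) 4 P := memLp_finsetSum s fun i _ => hY i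
    have hS0 : ∫ ω, ∑ i ∈ s, Y i ω ∂P = 0 := by
      rw [integral_finsetSum _ fun i _ => (hY i).integrable (by norm_num)]
      simp [h0]
    have hi : IndepFun (Y a) (fun ω => ∑ i ∈ s, Y i ω) P := by
      have := (hind.indepFun_finsetSum_of_notMem hm ha).symm
      convert this using 1
      ext ω; simp
    have h4 := integral_add_pow_four (hY a) hS hi (h0 a) hS0
    have h2 : ∫ ω, (Y a ω + ∑ i ∈ s, Y i ω) ^ 2 ∂P =
        ∫ ω, Y a ω ^ 2 ∂P + ∫ ω, (∑ i ∈ s, Y i ω) ^ 2 ∂P := by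
      have v1 := IndepFun.variance_fun_add ((hY a).mono_exponent (by norm_num))
        (hS.mono_exponent (by norm_num)) hi
      rwa [variance_of_integral_eq_zero (by fun_prop) (h0 a),
        variance_of_integral_eq_zero (by fun_prop) hS0, variance_of_integral_eq_zero (by fun_prop)]
        at v1
      rw [integral_add ((hY a).integrable (by norm_num)) (hS.integrable (by norm_num)), h0, hS0,
        add_zero]
    simp only [Finset.sum_insert ha, h4, h2, Finset.card_insert_of_notMem ha]
    push_cast
    have p1 : (∫ ω, Y a ω ^ 2 ∂P) * ∫ ω, (∑ i ∈ s, Y i ω) ^ 2 ∂P ≤ √c * (s.card * √c) :=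
      mul_le_mul (hv a) ih.1 (integral_nonneg fun ω => by positivity) (Real.sqrt_nonneg _)
    have p2 : √c * (s.card * √c) = s.card * c := by
      rw [mul_left_comm, Real.mul_self_sqrt hc0]
    constructor
    · linarith [hv a, ih.1]
    · linarith [hc a, ih.2]

/-- Cauchy–Schwarz, from the discriminant of the nonnegative quadratic t ↦ Var[X + tY]. -/
lemma abs_covariance_le {Ω : Type*} [MeasurableSpace Ω] {P : Measure Ω} [IsProbabilityMeasure P]
    {X Y : Ω → ℝ} (hX : MemLp X 2 P) (hY : MemLp Y 2 P) :
    |cov[X, Y; P]| ≤ √(Var[X; P] * Var[Y; P]) := by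
  refine Real.abs_le_sqrt ?_
  have h : ∀ t : ℝ, 0 ≤ Var[Y; P] * (t * t) + (2 * cov[X, Y; P]) * t + Var[X; P] := fun t => by
    have := variance_nonneg (X + t • Y) P
    rw [variance_add hX (hY.const_smul t), variance_smul, covariance_smul_right] at this
    linarith
  have := discrim_le_zero h
  rw [discrim] at this
  linarith

lemma abs_variance_add_sub_le {Ω : Type*} [MeasurableSpace Ω] {P : Measure Ω}
    [IsProbabilityMeasure P] {X Y : Ω → ℝ} (hX : MemLp X 2 P) (hY : MemLp Y 2 P) {D : ℝ}
    (hD : ∫ ω, Y ω ^ 2 ∂P ≤ D) :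
    |Var[X + Y; P] - Var[X; P]| ≤ 2 * √(Var[X; P] * D) + D := by
  have hYD : Var[Y; P] ≤ D := (variance_le_expectation_sq hY.aestronglyMeasurable).trans hD
  have h1 := (abs_covariance_le hX hY).trans
    (Real.sqrt_le_sqrt (mul_le_mul_of_nonneg_left hYD (variance_nonneg X P)))
  have h2 := variance_nonneg Y P
  rw [variance_add hX hY]
  rw [abs_le] at *
  constructor <;> linarith

/-! ### The delta method at a fixed sample size. -/

/-- `n ℓ` observations `Z ℓ j` with law `ν ℓ` for every `ℓ`, all of them independent. -/
structure IsMomentSample {Ω : Type*} [MeasurableSpace Ω] (P : Measure Ω) {L : ℕ} (h n : Fin L → ℕ)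
    (ν : Fin L → Measure ℝ) (Z : (ℓ : Fin L) → Fin (n ℓ) → Ω → ℝ) : Prop where
  measurable : ∀ ℓ j, Measurable (Z ℓ j)
  law : ∀ ℓ j, P.map (Z ℓ j) = ν ℓ
  indep : iIndepFun (fun p : (ℓ : Fin L) × Fin (n ℓ) => Z p.1 p.2) P
  integrable_pow : ∀ ℓ, ∀ q ≤ 4 * h ℓ, Integrable (fun z : ℝ => z ^ q) (ν ℓ)

/-- The fourth central moment of the power of `Z ∼ ν i.1` with index `i`. -/
noncomputable def centralFourthMoment {L : ℕ} (h : Fin L → ℕ) (ν : Fin L → Measure ℝ)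
    (i : MomentIndex h) : ℝ :=
  ∫ z, (z ^ (i.2.val + 1) - trueMoments h ν i) ^ 4 ∂(ν i.1)

lemma memLp_four_of_integrable_pow {μ : Measure ℝ} {q : ℕ}
    (hq : Integrable (fun z : ℝ => z ^ (4 * q)) μ) : MemLp (fun z : ℝ => z ^ q) 4 μ := by
  refine (integrable_norm_rpow_iff (by fun_prop) (by norm_num) (by norm_num)).1 ?_
  refine hq.congr (ae_of_all _ fun z => ?_)
  have : ((4 : ℝ≥0∞).toReal) = ((4 : ℕ) : ℝ) := by norm_num
  simp only [this, Real.rpow_natCast, Real.norm_eq_abs]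
  rw [Even.pow_abs (by decide), ← pow_mul, mul_comm]

namespace IsMomentSample

variable {Ω : Type*} [MeasurableSpace Ω] {P : Measure Ω} {L : ℕ}
  {h n : Fin L → ℕ} {ν : Fin L → Measure ℝ} {Z : (ℓ : Fin L) → Fin (n ℓ) → Ω → ℝ}

lemma measurable_pow (hs : IsMomentSample P h n ν Z) (ℓ : Fin L) (j : Fin (n ℓ)) (q : ℕ) :
    Measurable fun ω => Z ℓ j ω ^ q := (hs.measurable ℓ j).pow_const q

lemma memLp_pow (hs : IsMomentSample P h n ν Z) (i : MomentIndex h) (j : Fin (n i.1)) :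
    MemLp (fun ω => Z i.1 j ω ^ (i.2.val + 1)) 4 P := by
  have h1 := memLp_four_of_integrable_pow
    (hs.integrable_pow i.1 (4 * (i.2.val + 1)) (by have := i.2.isLt; omega))
  rw [← hs.law i.1 j] at h1
  exact h1.comp_of_map (hs.measurable i.1 j).aemeasurable

lemma integral_comp (hs : IsMomentSample P h n ν Z) {ℓ : Fin L} (j : Fin (n ℓ)) {f : ℝ → ℝ}
    (hf : Measurable f) : ∫ ω, f (Z ℓ j ω) ∂P = ∫ z, f z ∂(ν ℓ) := by
  rw [← hs.law ℓ j, integral_map (hs.measurable ℓ j).aemeasurable hf.aestronglyMeasurable]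

lemma integral_pow (hs : IsMomentSample P h n ν Z) {ℓ : Fin L} (j : Fin (n ℓ)) (q : ℕ) :
    ∫ ω, Z ℓ j ω ^ q ∂P = ∫ z, z ^ q ∂(ν ℓ) :=
  hs.integral_comp j (f := fun z => z ^ q) (by fun_prop)

lemma memLp_sampleMoments (hs : IsMomentSample P h n ν Z) (i : MomentIndex h) :
    MemLp (fun ω => sampleMoments h n (fun ℓ j => Z ℓ j ω) i) 4 P := by
  simp only [sampleMoments, div_eq_mul_inv]
  exact (memLp_finsetSum _ fun j _ => hs.memLp_pow i j).mul_const _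

lemma measurable_sampleMoments (hs : IsMomentSample P h n ν Z) :
    Measurable (fun ω => sampleMoments h n (fun ℓ j => Z ℓ j ω)) := by
  refine (WithLp.measurable_toLp 2 (MomentIndex h → ℝ)).comp (measurable_pi_lambda _ fun i => ?_)
  exact (Finset.measurable_sum _ fun j _ => hs.measurable_pow i.1 j _).div_const _

variable [IsProbabilityMeasure P]

/-- Only pairs consisting of one and the same observation contribute. The asymmetric denominator is
harmless: between different blocks `momentCov` is zero. -/
lemma covariance_sampleMoments (hs : IsMomentSample P h n ν Z) (hn : ∀ ℓ, 0 < n ℓ)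
    (i i' : MomentIndex h) :
    cov[fun ω => sampleMoments h n (fun ℓ j => Z ℓ j ω) i,
        fun ω => sampleMoments h n (fun ℓ j => Z ℓ j ω) i'; P] =
      momentCov h ν i i' / n i.1 := by
  have two (i : MomentIndex h) (j : Fin (n i.1)) :
      MemLp (fun ω => Z i.1 j ω ^ (i.2.val + 1)) 2 P :=
    (hs.memLp_pow i j).mono_exponent (by norm_num)
  simp only [sampleMoments]
  rw [covariance_fun_div_left, covariance_fun_div_right,
    covariance_fun_sum_fun_sum (two i) (two i')]
  have zero : ∀ (j : Fin (n i.1)) (j' : Fin (n i'.1)),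
      (⟨i.1, j⟩ : (ℓ : Fin L) × Fin (n ℓ)) ≠ ⟨i'.1, j'⟩ →
      cov[fun ω => Z i.1 j ω ^ (i.2.val + 1), fun ω => Z i'.1 j' ω ^ (i'.2.val + 1); P] = 0 :=
    fun j j' hj => ((hs.indep.indepFun hj).comp (φ := fun x : ℝ => x ^ (i.2.val + 1))
      (ψ := fun x : ℝ => x ^ (i'.2.val + 1)) (by fun_prop) (by fun_prop)).covariance_eq_zero
      (two i j) (two i' j')
  obtain ⟨ℓ, a⟩ := i
  obtain ⟨ℓ', b⟩ := i'
  by_cases hl : ℓ = ℓ'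
  · subst hl
    have hn' : (n ℓ : ℝ) ≠ 0 := by exact_mod_cast (hn ℓ).ne'
    have e : ∀ j : Fin (n ℓ), ∑ j' : Fin (n ℓ), cov[fun ω => Z ℓ j ω ^ (a.val + 1),
        fun ω => Z ℓ j' ω ^ (b.val + 1); P] = momentCov h ν ⟨ℓ, a⟩ ⟨ℓ, b⟩ := fun j => by
      rw [Finset.sum_eq_single j (fun j' _ hj' => zero j j' (by simpa using hj'.symm)) (by simp)]
      simp only [momentCov, Matrix.of_apply, if_true]
      rw [← hs.law ℓ j, covariance_map (by fun_prop) (by fun_prop) (hs.measurable ℓ j).aemeasurable]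
      rfl
    simp only [e, Finset.sum_const, Finset.card_univ, Fintype.card_fin, nsmul_eq_mul]
    field_simp
  · have e : ∀ (j : Fin (n ℓ)) (j' : Fin (n ℓ')), cov[fun ω => Z ℓ j ω ^ (a.val + 1),
        fun ω => Z ℓ' j' ω ^ (b.val + 1); P] = 0 :=
      fun j j' => zero j j' fun hj => hl (congrArg Sigma.fst hj)
    simp [e, momentCov, hl]

lemma integral_sampleMoments_sub_pow_four_le (hs : IsMomentSample P h n ν Z) (hn : ∀ ℓ, 0 < n ℓ)
    (i : MomentIndex h) :
    ∫ ω, (sampleMoments h n (fun ℓ j => Z ℓ j ω) i - trueMoments h ν i) ^ 4 ∂P ≤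
      3 * centralFourthMoment h ν i / (n i.1 : ℝ) ^ 2 := by
  have hn' : (0 : ℝ) < n i.1 := by exact_mod_cast hn i.1
  set μ := trueMoments h ν i with hμ
  let Y : Fin (n i.1) → Ω → ℝ := fun j ω => Z i.1 j ω ^ (i.2.val + 1) - μ
  have hY4 : ∀ j, MemLp (Y j) 4 P := fun j => (hs.memLp_pow i j).sub (memLp_const μ)
  have hY0 : ∀ j, ∫ ω, Y j ω ∂P = 0 := fun j => by
    rw [integral_sub ((hs.memLp_pow i j).integrable (by norm_num)) (integrable_const _),
      hs.integral_pow]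
    simp [hμ, trueMoments]
  have hYm : ∀ j, Measurable (Y j) := fun j => (hs.measurable_pow i.1 j _).sub_const μ
  have hYi : iIndepFun Y P := by
    have h1 : iIndepFun (fun j : Fin (n i.1) => Z i.1 j) P :=
      hs.indep.precomp (g := fun j : Fin (n i.1) => (⟨i.1, j⟩ : (ℓ : Fin L) × Fin (n ℓ)))
        fun j j' hj => by simpa using hj
    exact h1.comp (fun _ x => x ^ (i.2.val + 1) - μ) fun _ => by fun_prop
  have hYc : ∀ j, ∫ ω, Y j ω ^ 4 ∂P ≤ centralFourthMoment h ν i := fun j =>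
    (hs.integral_comp j (f := fun x => (x ^ (i.2.val + 1) - μ) ^ 4) (by fun_prop)).le
  have key := integral_sum_pow_four_le hYm hYi hY4 hY0 hYc Finset.univ
  rw [Finset.card_univ, Fintype.card_fin] at key
  have e : ∀ ω, (sampleMoments h n (fun ℓ j => Z ℓ j ω) i - μ) ^ 4 =
      (∑ j, Y j ω) ^ 4 / (n i.1 : ℝ) ^ 4 := fun ω => by
    rw [← div_pow]
    congr 1
    simp only [sampleMoments, Y, Finset.sum_sub_distrib, Finset.sum_const, Finset.card_univ,
      Fintype.card_fin, nsmul_eq_mul]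
    field_simp
  simp_rw [e]
  rw [integral_div, div_le_div_iff₀ (by positivity) (by positivity)]
  calc _ ≤ (3 * (n i.1 : ℝ) ^ 2 * centralFourthMoment h ν i) * (n i.1 : ℝ) ^ 2 := by gcongr
    _ = _ := by ring

/-- A nonasymptotic form of the delta method for variances. -/
lemma abs_variance_comp_sub_le (hs : IsMomentSample P h n ν Z) (hn : ∀ ℓ, 0 < n ℓ)
    {g : MomentSpace h → ℝ} (hg : Measurable g) (a : MomentIndex h → ℝ) {K : ℝ}
    (hK : ∀ x, |g x - g (trueMoments h ν) - ∑ i, a i * (x i - trueMoments h ν i)| ≤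
      K * ‖x - trueMoments h ν‖ ^ 2) {V D : ℝ}
    (hV : V = ∑ i, ∑ i', a i * a i' * (momentCov h ν i i' / n i.1))
    (hD : D = K ^ 2 * (Fintype.card (MomentIndex h) *
      ∑ i, 3 * centralFourthMoment h ν i / (n i.1 : ℝ) ^ 2)) :
    |Var[fun ω => g (sampleMoments h n (fun ℓ j => Z ℓ j ω)); P] - V| ≤ 2 * √(V * D) + D := by
  set x₀ := trueMoments h ν
  let X : Ω → MomentSpace h := fun ω => sampleMoments h n (fun ℓ j => Z ℓ j ω)
  have hX : Measurable X := hs.measurable_sampleMoments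
  have hXi : ∀ i, MemLp (fun ω => X ω i) 4 P := hs.memLp_sampleMoments
  have hXi2 : ∀ i, MemLp (fun ω => X ω i) 2 P := fun i => (hXi i).mono_exponent (by norm_num)
  have hXm : ∀ i, Measurable fun ω => X ω i := fun i =>
    (measurable_pi_apply i).comp ((WithLp.measurable_ofLp 2 _).comp hX)
  -- Up to an additive constant g(X) is `U + R`: `U` carries the leading variance, `R` is the Taylor
  -- remainder.
  let U : Ω → ℝ := fun ω => ∑ i, a i * X ω i
  let R : Ω → ℝ := fun ω => g (X ω) - g x₀ - ∑ i, a i * (X ω i - x₀ i)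
  have hU : MemLp U 2 P := memLp_finsetSum _ fun i _ => (hXi2 i).const_mul (a i)
  have hUV : Var[U; P] = V := by
    rw [← covariance_self hU.aemeasurable, hV,
      covariance_fun_sum_fun_sum (fun i => (hXi2 i).const_mul (a i))
        (fun i => (hXi2 i).const_mul (a i))]
    refine Finset.sum_congr rfl fun i _ => Finset.sum_congr rfl fun i' _ => ?_
    rw [covariance_const_mul_left, covariance_const_mul_right, hs.covariance_sampleMoments hn]
    ring
  have hRm : Measurable R := by
    refine ((hg.comp hX).sub_const _).sub ?_
    exact Finset.measurable_sum _ fun i _ => ((hXm i).sub_const _).const_mul _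
  have hi4 : ∀ i, Integrable (fun ω => (X ω i - x₀ i) ^ 4) P := fun i =>
    integrable_pow_of_memLp (p := 4)
      (by exact_mod_cast (hXi i).sub (memLp_const (x₀ i))) le_rfl
  have hbi : Integrable (fun ω => K ^ 2 * (Fintype.card (MomentIndex h) *
      ∑ i, (X ω i - x₀ i) ^ 4)) P :=
    ((integrable_finsetSum _ fun i _ => hi4 i).const_mul _).const_mul _
  have hRb : ∀ ω, R ω ^ 2 ≤ K ^ 2 * (Fintype.card (MomentIndex h) *
      ∑ i, (X ω i - x₀ i) ^ 4) := fun ω => by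
    have h1 : R ω ^ 2 ≤ (K * ‖X ω - x₀‖ ^ 2) ^ 2 := by
      rw [← sq_abs]
      exact pow_le_pow_left₀ (abs_nonneg _) (hK (X ω)) 2
    refine h1.trans ?_
    rw [mul_pow]
    gcongr
    rw [EuclideanSpace.real_norm_sq_eq]
    -- ‖v‖⁴ ≤ d ∑ vᵢ⁴ is the origin of the cardinality factor in `D`.
    have := sq_sum_le_card_mul_sum_sq (s := Finset.univ) (f := fun i => (X ω i - x₀ i) ^ 2)
    simpa [← pow_mul] using this
  have hR2 : MemLp R 2 P := by
    refine (memLp_two_iff_integrable_sq hRm.aestronglyMeasurable).2 ?_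
    refine hbi.mono' (hRm.pow_const 2).aestronglyMeasurable (ae_of_all _ fun ω => ?_)
    rw [Real.norm_eq_abs, abs_of_nonneg (sq_nonneg _)]
    exact hRb ω
  have hRD : ∫ ω, R ω ^ 2 ∂P ≤ D := by
    refine (integral_mono hR2.integrable_sq hbi hRb).trans ?_
    rw [integral_const_mul, integral_const_mul, integral_finsetSum _ fun i _ => hi4 i, hD]
    gcongr with i
    exact hs.integral_sampleMoments_sub_pow_four_le hn i
  have e : Var[fun ω => g (X ω); P] = Var[U + R; P] := by
    have : (fun ω => g (X ω)) = fun ω => (U + R) ω + (g x₀ - ∑ i, a i * x₀ i) := by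
      ext ω
      simp only [Pi.add_apply, U, R, mul_sub, Finset.sum_sub_distrib]
      ring
    rw [this, variance_add_const (hU.add hR2).aestronglyMeasurable]
  have := abs_variance_add_sub_le hU hR2 hRD
  rwa [← e, hUV] at this

end IsMomentSample

/-! ### Covariances and fourth central moments under convergence of raw moments. -/

section Moments

variable {L : ℕ} {h : Fin L → ℕ} {F : Fin L → Measure ℝ}

lemma momentCov_apply_self (hF : ∀ ℓ, IsProbabilityMeasure (F ℓ))
    (hint : ∀ ℓ, ∀ q ≤ 4 * h ℓ, Integrable (fun z : ℝ => z ^ q) (F ℓ)) (ℓ : Fin L)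
    (a b : Fin (h ℓ)) :
    momentCov h F ⟨ℓ, a⟩ ⟨ℓ, b⟩ = ∫ z, z ^ (a.val + 1 + (b.val + 1)) ∂(F ℓ) -
      (∫ z, z ^ (a.val + 1) ∂(F ℓ)) * ∫ z, z ^ (b.val + 1) ∂(F ℓ) := by
  have two : ∀ a : Fin (h ℓ), MemLp (fun z : ℝ => z ^ (a.val + 1)) 2 (F ℓ) := fun a =>
    (memLp_four_of_integrable_pow (hint ℓ _ (by have := a.isLt; omega))).mono_exponent
      (by norm_num)
  simp only [momentCov, Matrix.of_apply, if_true]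
  rw [covariance_eq_sub (two a) (two b)]
  simp [pow_add]

/-- As a polynomial in raw moments of order at most `4 * h ℓ`, the central moment inherits their
convergence along varying laws. -/
lemma centralFourthMoment_eq (hF : ∀ ℓ, IsProbabilityMeasure (F ℓ))
    (hint : ∀ ℓ, ∀ q ≤ 4 * h ℓ, Integrable (fun z : ℝ => z ^ q) (F ℓ)) (i : MomentIndex h) :
    centralFourthMoment h F i =
      ∫ z, z ^ (4 * (i.2.val + 1)) ∂(F i.1)
      - 4 * trueMoments h F i * ∫ z, z ^ (3 * (i.2.val + 1)) ∂(F i.1)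
      + 6 * trueMoments h F i ^ 2 * ∫ z, z ^ (2 * (i.2.val + 1)) ∂(F i.1)
      - 4 * trueMoments h F i ^ 3 * ∫ z, z ^ (1 * (i.2.val + 1)) ∂(F i.1)
      + trueMoments h F i ^ 4 := by
  have hi := i.2.isLt
  have j : ∀ k ≤ 4, ∀ c : ℝ, Integrable (fun z : ℝ => c * z ^ (k * (i.2.val + 1))) (F i.1) :=
    fun k hk c => (hint i.1 _ (Nat.mul_le_mul hk hi)).const_mul c
  set μ := trueMoments h F i
  have e : ∀ z : ℝ, (z ^ (i.2.val + 1) - μ) ^ 4 = ∑ k ∈ Finset.range 5,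
      ((-μ) ^ (4 - k) * Nat.choose 4 k) * z ^ (k * (i.2.val + 1)) := fun z => by
    rw [sub_eq_add_neg, add_pow]
    refine Finset.sum_congr rfl fun k _ => ?_
    rw [← pow_mul, mul_comm k]
    ring
  unfold centralFourthMoment
  change ∫ z, (z ^ (i.2.val + 1) - μ) ^ 4 ∂(F i.1) = _
  simp_rw [e]
  rw [integral_finsetSum _ fun k hk => j k (by simp at hk; omega) _]
  simp only [integral_const_mul, Finset.sum_range_succ, Finset.sum_range_zero]
  simp [Nat.choose]
  ring

variable {ν : ℕ → Fin L → Measure ℝ}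

lemma tendsto_trueMoments
    (hlim : ∀ ℓ, ∀ q ≤ 4 * h ℓ,
      Tendsto (fun m => ∫ z, z ^ q ∂(ν m ℓ)) atTop (𝓝 (∫ z, z ^ q ∂(F ℓ)))) (i : MomentIndex h) :
    Tendsto (fun m => trueMoments h (ν m) i) atTop (𝓝 (trueMoments h F i)) :=
  hlim i.1 _ (by have := i.2.isLt; omega)

variable (hF : ∀ ℓ, IsProbabilityMeasure (F ℓ))
    (hint : ∀ ℓ, ∀ q ≤ 4 * h ℓ, Integrable (fun z : ℝ => z ^ q) (F ℓ))
    (hν : ∀ᶠ m in atTop, ∀ ℓ, IsProbabilityMeasure (ν m ℓ))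
    (hνint : ∀ᶠ m in atTop, ∀ ℓ, ∀ q ≤ 4 * h ℓ, Integrable (fun z : ℝ => z ^ q) (ν m ℓ))
    (hlim : ∀ ℓ, ∀ q ≤ 4 * h ℓ,
      Tendsto (fun m => ∫ z, z ^ q ∂(ν m ℓ)) atTop (𝓝 (∫ z, z ^ q ∂(F ℓ))))

include hF hint hν hνint hlim

lemma tendsto_momentCov (i i' : MomentIndex h) :
    Tendsto (fun m => momentCov h (ν m) i i') atTop (𝓝 (momentCov h F i i')) := by
  obtain ⟨ℓ, a⟩ := i
  obtain ⟨ℓ', b⟩ := i'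
  have ha := a.isLt
  have hb := b.isLt
  by_cases hl : ℓ = ℓ'
  · subst hl
    rw [momentCov_apply_self hF hint]
    refine Tendsto.congr' ?_ ((hlim ℓ (a.val + 1 + (b.val + 1)) (by omega)).sub
      ((hlim ℓ (a.val + 1) (by omega)).mul (hlim ℓ (b.val + 1) (by omega))))
    filter_upwards [hν, hνint] with m h1 h2
    rw [momentCov_apply_self h1 h2]
  · simp [momentCov, hl]

lemma tendsto_centralFourthMoment (i : MomentIndex h) :
    Tendsto (fun m => centralFourthMoment h (ν m) i) atTop (𝓝 (centralFourthMoment h F i)) := by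
  rw [centralFourthMoment_eq hF hint]
  have hi := i.2.isLt
  have hμ := tendsto_trueMoments hlim i
  have t : ∀ k ≤ 4, Tendsto (fun m => ∫ z, z ^ (k * (i.2.val + 1)) ∂(ν m i.1)) atTop
      (𝓝 (∫ z, z ^ (k * (i.2.val + 1)) ∂(F i.1))) := fun k hk =>
    hlim i.1 _ (Nat.mul_le_mul hk hi)
  refine Tendsto.congr' ?_ (((((t 4 le_rfl).sub ((hμ.const_mul 4).mul (t 3 (by norm_num)))).add
    (((hμ.pow 2).const_mul 6).mul (t 2 (by norm_num)))).sub
    (((hμ.pow 3).const_mul 4).mul (t 1 (by norm_num)))).add (hμ.pow 4))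
  filter_upwards [hν, hνint] with m h1 h2
  rw [centralFourthMoment_eq h1 h2]

end Moments

/-! ### Asymptotics of the variance, and the uniform Taylor bound. -/

/-- The factor m enters the root symmetrically: m√(VD) = √(mV · mD), which tends to √(σ · 0) = 0. -/
lemma tendsto_mul_of_abs_sub_le {v V D : ℕ → ℝ} {σ : ℝ}
    (hb : ∀ᶠ m in atTop, |v m - V m| ≤ 2 * √(V m * D m) + D m)
    (hV : Tendsto (fun m : ℕ => (m : ℝ) * V m) atTop (𝓝 σ))
    (hD : Tendsto (fun m : ℕ => (m : ℝ) * D m) atTop (𝓝 0)) :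
    Tendsto (fun m : ℕ => (m : ℝ) * v m) atTop (𝓝 σ) := by
  have h0 : Tendsto (fun m : ℕ => 2 * √(((m : ℝ) * V m) * ((m : ℝ) * D m)) + (m : ℝ) * D m) atTop
      (𝓝 0) := by
    have := ((((hV.mul hD).sqrt).const_mul 2).add hD)
    simpa using this
  have h1 : Tendsto (fun m : ℕ => (m : ℝ) * v m - (m : ℝ) * V m) atTop (𝓝 0) := by
    refine squeeze_zero_norm' ?_ h0
    filter_upwards [hb] with m hm
    rw [← mul_sub, norm_mul, Real.norm_eq_abs, Real.norm_eq_abs, Nat.abs_cast]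
    have e : √(((m : ℝ) * V m) * ((m : ℝ) * D m)) = m * √(V m * D m) := by
      rw [show ((m : ℝ) * V m) * ((m : ℝ) * D m) = (m : ℝ) ^ 2 * (V m * D m) by ring,
        Real.sqrt_mul (by positivity), Real.sqrt_sq (by positivity)]
    rw [e]
    nlinarith [mul_le_mul_of_nonneg_left hm (Nat.cast_nonneg (α := ℝ) m)]
  simpa using h1.add hV

lemma tendsto_mul_inv_of_div_tendsto_one {n : ℕ → ℕ}
    (hn : Tendsto (fun m : ℕ => (n m : ℝ) / (m : ℝ)) atTop (𝓝 1)) :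
    Tendsto (fun m : ℕ => (m : ℝ) / (n m : ℝ)) atTop (𝓝 1) := by
  simpa using hn.inv₀ one_ne_zero

lemma tendsto_atTop_of_div_tendsto_one {n : ℕ → ℕ}
    (hn : Tendsto (fun m : ℕ => (n m : ℝ) / (m : ℝ)) atTop (𝓝 1)) :
    Tendsto n atTop atTop := by
  rw [← tendsto_natCast_atTop_iff (R := ℝ)]
  refine (hn.pos_mul_atTop one_pos tendsto_natCast_atTop_atTop).congr' ?_
  filter_upwards [eventually_gt_atTop 0] with m hm
  have : (m : ℝ) ≠ 0 := by exact_mod_cast hm.ne'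
  field_simp

/-- The delta method for variances of functions of sample moments: `m` times the variance
converges, for samples of sizes `N m ℓ ∼ m` whose laws have converging moments. -/
theorem tendsto_mul_variance_comp_sampleMoments {Ω : Type*} [MeasurableSpace Ω] {P : Measure Ω}
    [IsProbabilityMeasure P] {L : ℕ} {h : Fin L → ℕ} {F : Fin L → Measure ℝ}
    (hF : ∀ ℓ, IsProbabilityMeasure (F ℓ))
    (hint : ∀ ℓ, ∀ q ≤ 4 * h ℓ, Integrable (fun z : ℝ => z ^ q) (F ℓ))
    {N : ℕ → Fin L → ℕ} (hN : ∀ ℓ, Tendsto (fun m : ℕ => (N m ℓ : ℝ) / (m : ℝ)) atTop (𝓝 1))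
    {ν : ℕ → Fin L → Measure ℝ} {Z : (m : ℕ) → (ℓ : Fin L) → Fin (N m ℓ) → Ω → ℝ}
    (hs : ∀ᶠ m in atTop, IsMomentSample P h (N m) (ν m) (Z m))
    (hlim : ∀ ℓ, ∀ q ≤ 4 * h ℓ,
      Tendsto (fun m => ∫ z, z ^ q ∂(ν m ℓ)) atTop (𝓝 (∫ z, z ^ q ∂(F ℓ))))
    {g : MomentSpace h → ℝ} (hg : Measurable g) {a : ℕ → MomentIndex h → ℝ}
    {a' : MomentIndex h → ℝ} (ha : ∀ i, Tendsto (fun m => a m i) atTop (𝓝 (a' i))) {K : ℝ}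
    (hK : ∀ᶠ m in atTop, ∀ x,
      |g x - g (trueMoments h (ν m)) - ∑ i, a m i * (x i - trueMoments h (ν m) i)| ≤
        K * ‖x - trueMoments h (ν m)‖ ^ 2) :
    Tendsto (fun m : ℕ => (m : ℝ) *
        Var[fun ω => g (sampleMoments h (N m) (fun ℓ j => Z m ℓ j ω)); P]) atTop
      (𝓝 (∑ i, ∑ i', a' i * a' i' * momentCov h F i i')) := by
  have hpos : ∀ᶠ m in atTop, ∀ ℓ, 0 < N m ℓ := eventually_all.2 fun ℓ =>
    (tendsto_atTop_of_div_tendsto_one (hN ℓ)).eventually_gt_atTop 0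
  have hν : ∀ᶠ m in atTop, ∀ ℓ, IsProbabilityMeasure (ν m ℓ) := by
    filter_upwards [hpos, hs] with m h1 h2 ℓ
    rw [← h2.law ℓ ⟨0, h1 ℓ⟩]
    exact Measure.isProbabilityMeasure_map (h2.measurable _ _).aemeasurable
  have hνint : ∀ᶠ m in atTop, ∀ ℓ, ∀ q ≤ 4 * h ℓ, Integrable (fun z : ℝ => z ^ q) (ν m ℓ) :=
    hs.mono fun m h2 => h2.integrable_pow
  refine tendsto_mul_of_abs_sub_le (by
    filter_upwards [hpos, hs, hK] with m h1 h2 h3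
    exact h2.abs_variance_comp_sub_le h1 hg (a m) h3 rfl rfl) ?_ ?_
  · simp_rw [Finset.mul_sum]
    refine tendsto_finsetSum _ fun i _ => tendsto_finsetSum _ fun i' _ => ?_
    have := (((ha i).mul (ha i')).mul (tendsto_momentCov hF hint hν hνint hlim i i')).mul
      (tendsto_mul_inv_of_div_tendsto_one (hN i.1))
    rw [mul_one] at this
    refine this.congr fun m => ?_
    ring
  · have h1 : ∀ i : MomentIndex h, Tendsto (fun m : ℕ => (m : ℝ) *
        (3 * centralFourthMoment h (ν m) i / (N m i.1 : ℝ) ^ 2)) atTop (𝓝 0) := fun i => by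
      have := (((tendsto_centralFourthMoment hF hint hν hνint hlim i).const_mul 3).mul
        (tendsto_mul_inv_of_div_tendsto_one (hN i.1))).mul (tendsto_inv_atTop_zero.comp
        (tendsto_natCast_atTop_atTop (R := ℝ) |>.comp (tendsto_atTop_of_div_tendsto_one (hN i.1))))
      rw [mul_zero] at this
      refine this.congr fun m => ?_
      simp only [Function.comp]
      ring
    have h2 := ((tendsto_finsetSum (Finset.univ : Finset (MomentIndex h))
      fun i _ => h1 i).const_mul (Fintype.card (MomentIndex h) : ℝ)).const_mul (K ^ 2)
    simp only [Finset.sum_const_zero, mul_zero] at h2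
    refine h2.congr fun m => ?_
    rw [← Finset.mul_sum]
    ring

/-- A bounded `C²` function has a quadratic first-order Taylor remainder, uniformly over base points
near `c` and over all of space. -/
lemma exists_abs_sub_sub_fderiv_le {E : Type*} [NormedAddCommGroup E] [NormedSpace ℝ E]
    [ProperSpace E] {g : E → ℝ} (hg : ContDiff ℝ 2 g) {B : ℝ} (hB : ∀ x, |g x| ≤ B) (c : E) :
    ∃ K, ∀ x₀ ∈ Metric.ball c 1, ∀ x,
      |g x - g x₀ - fderiv ℝ g x₀ (x - x₀)| ≤ K * ‖x - x₀‖ ^ 2 := by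
  have h1 : ContDiff ℝ 1 (fderiv ℝ g) := hg.fderiv_right (by norm_num)
  obtain ⟨C, hC⟩ := LocallyLipschitzOn.exists_lipschitzOnWith_of_compact
    (isCompact_closedBall c 2) (h1.locallyLipschitz.locallyLipschitzOn (s := Metric.closedBall c 2))
  obtain ⟨D, hD⟩ := (isCompact_closedBall c 2).exists_bound_of_continuousOn
    h1.continuous.continuousOn
  have hB0 : 0 ≤ B := (abs_nonneg _).trans (hB c)
  have hD0 : 0 ≤ D := (norm_nonneg _).trans (hD c (by simp))
  -- Within distance 1 of `x₀` one stays in the ball of radius 2 about `c`, where the derivative is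
  -- `C`-Lipschitz, and the mean value inequality applies. Farther away the crude bound 2B + D‖x -
  -- x₀‖ is at most (2B + D)‖x - x₀‖².
  refine ⟨C + (2 * B + D), fun x₀ hx₀ x => ?_⟩
  rw [Metric.mem_ball] at hx₀
  rcases le_total ‖x - x₀‖ 1 with h | h
  · have hs : ∀ y ∈ Metric.closedBall x₀ ‖x - x₀‖, y ∈ Metric.closedBall c 2 := fun y hy => by
      rw [Metric.mem_closedBall] at hy ⊢
      linarith [dist_triangle y x₀ c]
    have := Convex.norm_image_sub_le_of_norm_fderiv_le' (𝕜 := ℝ) (f := g)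
      (s := Metric.closedBall x₀ ‖x - x₀‖) (φ := fderiv ℝ g x₀) (C := C * ‖x - x₀‖) (x := x₀)
      (y := x) (fun y _ => (hg.differentiable (by norm_num)) y) (fun y hy => by
        refine (hC.norm_sub_le (hs y hy) (hs x₀ (Metric.mem_closedBall_self (norm_nonneg _)))).trans
          ?_
        gcongr
        simpa [dist_eq_norm] using hy) (convex_closedBall _ _)
      (Metric.mem_closedBall_self (norm_nonneg _)) (by simp [dist_eq_norm])
    rw [Real.norm_eq_abs] at this
    refine this.trans ?_
    nlinarith [sq_nonneg ‖x - x₀‖]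
  · have hx₀D : ‖fderiv ℝ g x₀‖ ≤ D := hD x₀ (by rw [Metric.mem_closedBall]; linarith)
    have h2 : |fderiv ℝ g x₀ (x - x₀)| ≤ D * ‖x - x₀‖ :=
      (ContinuousLinearMap.le_opNorm _ _).trans
        (mul_le_mul_of_nonneg_right hx₀D (norm_nonneg _))
    have h3 : |g x - g x₀ - fderiv ℝ g x₀ (x - x₀)| ≤ B + B + D * ‖x - x₀‖ :=
      (abs_sub _ _).trans (add_le_add ((abs_sub _ _).trans (add_le_add (hB _) (hB _))) h2)
    refine h3.trans ?_
    have h4 : ‖x - x₀‖ ≤ ‖x - x₀‖ ^ 2 := by nlinarith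
    have h5 : (1 : ℝ) ≤ ‖x - x₀‖ ^ 2 := h.trans h4
    nlinarith [mul_le_mul_of_nonneg_left h4 hD0, mul_le_mul_of_nonneg_left h5 hB0,
      mul_nonneg C.coe_nonneg (sq_nonneg ‖x - x₀‖)]

/-! ### Empirical measures and the strong law for the data. -/

section Empirical

/-- The empirical measure of a sample. -/
noncomputable def empiricalMeasure {n : ℕ} (z : Fin n → ℝ) : Measure ℝ :=
  (n : ℝ≥0∞)⁻¹ • ∑ j, Measure.dirac (z j)

lemma integrable_empiricalMeasure {n : ℕ} (z : Fin n → ℝ) (f : ℝ → ℝ) :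
    Integrable f (empiricalMeasure z) := by
  -- For n = 0 the scalar is ∞, but the empty sum makes the measure zero.
  rcases Nat.eq_zero_or_pos n with rfl | hn
  · simp [empiricalMeasure]
  · refine Integrable.smul_measure ?_ (by simp [hn.ne'])
    exact integrable_finsetSum_measure.2 fun j _ => integrable_dirac (by simp)

lemma integral_empiricalMeasure {n : ℕ} (z : Fin n → ℝ) (f : ℝ → ℝ) :
    ∫ x, f x ∂(empiricalMeasure z) = (∑ j, f (z j)) / (n : ℝ) := by
  rw [empiricalMeasure, integral_smul_measure,
    integral_finsetSum_measure fun j _ => integrable_dirac (by simp)]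
  simp [div_eq_inv_mul]

lemma map_eq_empiricalMeasure {Ω : Type*} [MeasurableSpace Ω] {P : Measure Ω} {n : ℕ}
    (z : Fin n → ℝ) {J : Ω → Fin n} (hJ : Measurable J)
    (hu : ∀ i, P {ω | J ω = i} = (n : ℝ≥0∞)⁻¹) :
    P.map (fun ω => z (J ω)) = empiricalMeasure z := by
  have h1 : P.map J = (n : ℝ≥0∞)⁻¹ • ∑ j : Fin n, Measure.dirac j := by
    refine Measure.ext_of_singleton fun i => ?_
    rw [Measure.map_apply hJ (measurableSet_singleton i)]
    change P {ω | J ω = i} = _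
    rw [hu i]
    simp [Measure.dirac_apply', Set.indicator_apply]
  have h2 : P.map (fun ω => z (J ω)) = (P.map J).map z :=
    (Measure.map_map (by fun_prop) hJ).symm
  rw [h2, h1, Measure.map_smul, empiricalMeasure]
  congr 1
  have hz : Measurable z := measurable_of_finite z
  rw [← Measure.mapₗ_apply_of_measurable hz, map_sum]
  simp only [Measure.mapₗ_apply_of_measurable hz, Measure.map_dirac' hz]

end Empirical

/-- The strong law for each of the countably many pairs (ℓ, q), so a single null set suffices.
Outside it the empirical measures satisfy the moment convergence that the delta method requires of
its laws. -/
lemma IsInputData.ae_tendsto_moments {Ω : Type*} [MeasurableSpace Ω] {P : Measure Ω} {L : ℕ}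
    {F : Fin L → Measure ℝ} {Z : Fin L → ℕ → Ω → ℝ} (hZ : IsInputData P F Z) {h : Fin L → ℕ}
    (hint : ∀ ℓ, ∀ q ≤ 4 * h ℓ, Integrable (fun z : ℝ => z ^ q) (F ℓ)) :
    ∀ᵐ ω ∂P, ∀ ℓ, ∀ q ≤ 4 * h ℓ,
      Tendsto (fun n : ℕ => (∑ j : Fin n, Z ℓ j ω ^ q) / (n : ℝ)) atTop (𝓝 (∫ z, z ^ q ∂(F ℓ))) := by
  refine ae_all_iff.2 fun ℓ => ae_all_iff.2 fun q => ?_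
  by_cases hq : q ≤ 4 * h ℓ
  swap
  · exact ae_of_all _ fun ω h' => absurd h' hq
  have hid : ∀ j, IdentDistrib (Z ℓ j) (Z ℓ 0) P P := fun j =>
    ⟨(hZ.measurable ℓ j).aemeasurable, (hZ.measurable ℓ 0).aemeasurable, by
      rw [hZ.law, hZ.law]⟩
  have hi : Integrable (fun ω => Z ℓ 0 ω ^ q) P := by
    have := hint ℓ q hq
    rw [← hZ.law ℓ 0] at this
    exact this.comp_measurable (hZ.measurable ℓ 0)
  have e : ∫ ω, Z ℓ 0 ω ^ q ∂P = ∫ z, z ^ q ∂(F ℓ) := by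
    rw [← hZ.law ℓ 0, integral_map (hZ.measurable ℓ 0).aemeasurable (by fun_prop)]
  have := strong_law_ae_real (fun j ω => Z ℓ j ω ^ q) hi (fun j j' hj =>
    (hZ.indep.indepFun (i := (ℓ, j)) (j := (ℓ, j')) (by simpa using hj)).comp
      (φ := fun x : ℝ => x ^ q) (ψ := fun x : ℝ => x ^ q) (by fun_prop) (by fun_prop))
    (fun j => (hid j).comp (u := fun x : ℝ => x ^ q) (by fun_prop))
  filter_upwards [this] with ω hω _
  rw [e] at hω
  refine hω.congr fun n => ?_
  rw [Finset.sum_range]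

/-! ### Bootstrap resamples and the limit in the number of resamples. -/

section Bootstrap

/-- The frequencies of the values of i.i.d. random elements of a finite type converge, hence so do
the averages of all functions simultaneously. -/
lemma ae_tendsto_average_of_finite {Ω T : Type*} [MeasurableSpace Ω] {P : Measure Ω}
    [IsProbabilityMeasure P] [Fintype T] [MeasurableSpace T] [MeasurableSingletonClass T]
    {J : ℕ → Ω → T} (hm : ∀ b, Measurable (J b)) (hind : Pairwise fun b b' => IndepFun (J b) (J b') P)
    (hid : ∀ b, P.map (J b) = P.map (J 0)) :
    ∀ᵐ ω ∂P, ∀ f : T → ℝ, Tendsto (fun B : ℕ => (∑ b ∈ Finset.range B, f (J b ω)) / (B : ℝ)) atTop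
      (𝓝 (∫ ω', f (J 0 ω') ∂P)) := by
  classical
  -- Indicators of points span all functions on `T`, so finitely many strong laws give one null set
  -- valid for the uncountably many `f`.
  let u : T → T → ℝ := fun t s => if s = t then 1 else 0
  have hu : ∀ t, Measurable (u t) := fun t => measurable_of_finite _
  have hi : ∀ t, Integrable (fun ω => u t (J 0 ω)) P := fun t => by
    refine Integrable.of_bound ((hu t).comp (hm 0)).aestronglyMeasurable 1 (ae_of_all _ fun ω => ?_)
    simp only [u]
    split_ifs <;> simp
  have key : ∀ᵐ ω ∂P, ∀ t, Tendsto (fun B : ℕ => (∑ b ∈ Finset.range B, u t (J b ω)) / (B : ℝ)) atTop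
      (𝓝 (∫ ω', u t (J 0 ω') ∂P)) := ae_all_iff.2 fun t =>
    strong_law_ae_real (fun b ω => u t (J b ω)) (hi t)
      (fun b b' hb => (hind hb).comp (hu t) (hu t))
      (fun b => (IdentDistrib.mk (hm b).aemeasurable (hm 0).aemeasurable (hid b)).comp (hu t))
  have dec : ∀ (f : T → ℝ) (s : T), f s = ∑ t, f t * u t s := fun f s => by
    simp [u]
  filter_upwards [key] with ω hω f
  have e : ∫ ω', f (J 0 ω') ∂P = ∑ t, f t * ∫ ω', u t (J 0 ω') ∂P := by
    simp_rw [← integral_const_mul]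
    rw [← integral_finsetSum _ fun t _ => (hi t).const_mul (f t)]
    exact integral_congr_ae (ae_of_all _ fun ω' => dec f _)
  rw [e]
  refine (tendsto_finsetSum _ fun t _ => (hω t).const_mul (f t)).congr fun B => ?_
  simp_rw [← mul_div_assoc, ← Finset.sum_div, Finset.mul_sum]
  rw [Finset.sum_comm]
  congr 1
  exact Finset.sum_congr rfl fun b _ => (dec f _).symm

/-- This reduces convergence to averages of `v` and `v²`, with a correction factor B/(B - 1) tending
to 1. -/
lemma sampleVariance_eq (B : ℕ) (v : ℕ → ℝ) :
    sampleVariance B v = ((∑ b ∈ Finset.range B, v b ^ 2) / (B : ℝ) -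
      ((∑ b ∈ Finset.range B, v b) / (B : ℝ)) ^ 2) * ((B : ℝ) / ((B : ℝ) - 1)) := by
  rcases Nat.eq_zero_or_pos B with rfl | hB
  · simp [sampleVariance]
  have hB' : (B : ℝ) ≠ 0 := by exact_mod_cast hB.ne'
  unfold sampleVariance
  set m := (∑ b ∈ Finset.range B, v b) / (B : ℝ) with hm
  have hS : ∑ b ∈ Finset.range B, v b = B * m := by rw [hm]; field_simp
  have e : ∑ b ∈ Finset.range B, (v b - m) ^ 2 = ∑ b ∈ Finset.range B, v b ^ 2 - B * m ^ 2 := by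
    have e1 : ∀ b, (v b - m) ^ 2 = v b ^ 2 - 2 * m * v b + m ^ 2 := fun b => by ring
    simp_rw [e1, Finset.sum_add_distrib, Finset.sum_sub_distrib, ← Finset.mul_sum, hS]
    simp
    ring
  rw [e]
  field_simp

lemma tendsto_sampleVariance {v : ℕ → ℝ} {a b : ℝ}
    (h1 : Tendsto (fun B : ℕ => (∑ i ∈ Finset.range B, v i) / (B : ℝ)) atTop (𝓝 a))
    (h2 : Tendsto (fun B : ℕ => (∑ i ∈ Finset.range B, v i ^ 2) / (B : ℝ)) atTop (𝓝 b)) :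
    Tendsto (fun B => sampleVariance B v) atTop (𝓝 (b - a ^ 2)) := by
  simp_rw [sampleVariance_eq]
  have h3 : Tendsto (fun B : ℕ => (B : ℝ) / ((B : ℝ) - 1)) atTop (𝓝 1) := by
    have := tendsto_natCast_div_add_atTop (-1 : ℝ)
    simpa [sub_eq_add_neg] using this
  simpa using (h2.sub (h1.pow 2)).mul h3

variable {Ω : Type*} [MeasurableSpace Ω] {P : Measure Ω} {L : ℕ} {N : ℕ → Fin L → ℕ}
  {I : (m : ℕ) → ℕ → (ℓ : Fin L) → Fin (N m ℓ) → Ω → Fin (N m ℓ)}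

/-- The indices drawn for the `b`-th resample, as a random element of a finite type. -/
def resampleIndices (I : (m : ℕ) → ℕ → (ℓ : Fin L) → Fin (N m ℓ) → Ω → Fin (N m ℓ)) (m b : ℕ)
    (ω : Ω) (p : (ℓ : Fin L) × Fin (N m ℓ)) : Fin (N m p.1) :=
  I m b p.1 p.2 ω

lemma IsBootstrap.measurable_resampleIndices (hI : IsBootstrap P N I) (m b : ℕ) :
    Measurable (resampleIndices I m b) :=
  measurable_pi_lambda _ fun p => hI.measurable m b p.1 p.2

/-- Different resamples use disjoint blocks of one independent family of draws. -/
lemma IsBootstrap.indepFun_resampleIndices (hI : IsBootstrap P N I) (m : ℕ) {b b' : ℕ}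
    (hb : b ≠ b') : IndepFun (resampleIndices I m b) (resampleIndices I m b') P := by
  classical
  let S : ℕ → Finset (ℕ × ((ℓ : Fin L) × Fin (N m ℓ))) := fun b =>
    Finset.univ.image fun p => (b, p)
  have hS : ∀ b p, (b, p) ∈ S b := fun b p => by simp [S]
  have hd : Disjoint (S b) (S b') := by
    rw [Finset.disjoint_left]
    intro q hq hq'
    simp only [S, Finset.mem_image, Finset.mem_univ, true_and] at hq hq'
    obtain ⟨p, rfl⟩ := hq
    obtain ⟨p', hp'⟩ := hq'
    exact hb (congrArg Prod.fst hp').symm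
  have := (hI.indep m).indepFun_finset (S b) (S b') hd fun p => hI.measurable m p.1 p.2.1 p.2.2
  exact this.comp (φ := fun f p => f ⟨(b, p), hS b p⟩) (ψ := fun f p => f ⟨(b', p), hS b' p⟩)
    (measurable_pi_lambda _ fun p => measurable_pi_apply _)
    (measurable_pi_lambda _ fun p => measurable_pi_apply _)

lemma IsBootstrap.iIndepFun_resample (hI : IsBootstrap P N I) (m b : ℕ) :
    iIndepFun (fun p : (ℓ : Fin L) × Fin (N m ℓ) => I m b p.1 p.2) P :=
  (hI.indep m).precomp (g := fun p : (ℓ : Fin L) × Fin (N m ℓ) => (b, p))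
    fun p p' hp => by simpa using hp

lemma IsBootstrap.map_resampleIndices (hI : IsBootstrap P N I) (m b : ℕ) :
    P.map (resampleIndices I m b) = P.map (resampleIndices I m 0) := by
  have key : ∀ b t, P.map (resampleIndices I m b) {t} =
      ∏ p : (ℓ : Fin L) × Fin (N m ℓ), (N m p.1 : ℝ≥0∞)⁻¹ := fun b t => by
    rw [Measure.map_apply (hI.measurable_resampleIndices m b) (measurableSet_singleton t)]
    have e : resampleIndices I m b ⁻¹' {t} =
        ⋂ p ∈ (Finset.univ : Finset ((ℓ : Fin L) × Fin (N m ℓ))), I m b p.1 p.2 ⁻¹' {t p} := by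
      ext ω
      simp [funext_iff, resampleIndices]
    rw [e, (hI.iIndepFun_resample m b).measure_inter_preimage_eq_mul _
      fun p _ => measurableSet_singleton _]
    exact Finset.prod_congr rfl fun p _ => hI.uniform m b p.1 p.2 (t p)
  exact Measure.ext_of_singleton fun t => by rw [key, key]

/-- A bootstrap resample of fixed data is a sample from the empirical measures. -/
lemma IsBootstrap.isMomentSample (hI : IsBootstrap P N I) (h : Fin L → ℕ) (m b : ℕ)
    (z : (ℓ : Fin L) → Fin (N m ℓ) → ℝ) :
    IsMomentSample P h (N m) (fun ℓ => empiricalMeasure (z ℓ))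
      (fun ℓ j ω => z ℓ (I m b ℓ j ω)) where
  measurable ℓ j := (measurable_of_finite (z ℓ)).comp (hI.measurable m b ℓ j)
  law ℓ j := map_eq_empiricalMeasure (z ℓ) (hI.measurable m b ℓ j) (hI.uniform m b ℓ j)
  indep := (hI.iIndepFun_resample m b).comp (fun p => z p.1) fun _ => measurable_of_finite _
  integrable_pow _ _ _ := integrable_empiricalMeasure _ _

/-- As the number of resamples grows, the bootstrap sample variance of any statistic converges to
its variance over resamples of the observed data. -/
lemma IsBootstrap.ae_tendsto_sampleVariance [IsProbabilityMeasure P] (hI : IsBootstrap P N I) :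
    ∀ᵐ ω ∂P, ∀ (m : ℕ) (φ : ((ℓ : Fin L) → Fin (N m ℓ) → Fin (N m ℓ)) → ℝ),
      Tendsto (fun B => sampleVariance B fun b => φ fun ℓ j => I m b ℓ j ω) atTop
        (𝓝 Var[fun ω' => φ fun ℓ j => I m 0 ℓ j ω'; P]) := by
  -- The null set must not depend on `φ`: in the application `φ` is built from the data and outputs
  -- at the same `ω`.
  have key := ae_all_iff.2 fun m => ae_tendsto_average_of_finite (hI.measurable_resampleIndices m)
    (fun b b' hb => hI.indepFun_resampleIndices m hb) (hI.map_resampleIndices m)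
  filter_upwards [key] with ω hω m φ
  let f : ((p : (ℓ : Fin L) × Fin (N m ℓ)) → Fin (N m p.1)) → ℝ := fun t => φ fun ℓ j => t ⟨ℓ, j⟩
  have hf : MemLp (fun ω' => f (resampleIndices I m 0 ω')) 2 P := by
    obtain ⟨C, hC⟩ := (Set.finite_range f).bddAbove
    obtain ⟨c, hc⟩ := (Set.finite_range f).bddBelow
    exact memLp_of_bounded (a := c) (b := C) (ae_of_all _ fun ω' => ⟨hc ⟨_, rfl⟩, hC ⟨_, rfl⟩⟩)
      ((measurable_of_finite f).comp (hI.measurable_resampleIndices m 0)).aestronglyMeasurable 2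
  have h1 := tendsto_sampleVariance (hω m f) (hω m fun t => f t ^ 2)
  have e : Var[fun ω' => f (resampleIndices I m 0 ω'); P] =
      ∫ ω', f (resampleIndices I m 0 ω') ^ 2 ∂P - (∫ ω', f (resampleIndices I m 0 ω') ∂P) ^ 2 := by
    rw [variance_eq_sub hf]
    rfl
  rw [← e] at h1
  exact h1

end Bootstrap

/-! ### The delta method for smooth bounded functions. -/

section DeltaMethod

lemma fderiv_eq_sum_gradient {ι : Type*} [Fintype ι] (g : EuclideanSpace ℝ ι → ℝ)
    (x v : EuclideanSpace ℝ ι) : fderiv ℝ g x v = ∑ i, gradient g x i * v i := by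
  rw [gradient, ← InnerProductSpace.toDual_symm_apply, PiLp.inner_apply]
  exact Finset.sum_congr rfl fun i _ => by simp [mul_comm]

lemma continuous_gradient {E : Type*} [NormedAddCommGroup E] [InnerProductSpace ℝ E]
    [CompleteSpace E] {g : E → ℝ} (hg : ContDiff ℝ 2 g) : Continuous (gradient g) :=
  (InnerProductSpace.toDual ℝ E).symm.continuous.comp (hg.continuous_fderiv (by norm_num))

lemma deltaVariance_eq_sum {ι : Type*} [Fintype ι] (g : EuclideanSpace ℝ ι → ℝ) (Λ : Matrix ι ι ℝ)
    (x : EuclideanSpace ℝ ι) :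
    deltaVariance g Λ x = ∑ i, ∑ i', gradient g x i * gradient g x i' * Λ i i' := by
  simp only [deltaVariance, dotProduct, Matrix.mulVec, Finset.mul_sum]
  exact Finset.sum_congr rfl fun i _ => Finset.sum_congr rfl fun j _ => by ring

variable {Ω : Type*} [MeasurableSpace Ω] {P : Measure Ω} {L : ℕ}
  {h : Fin L → ℕ} {F : Fin L → Measure ℝ} {N : ℕ → Fin L → ℕ}

/-- The delta method for bounded `C²` functions of sample moments. -/
theorem tendsto_mul_variance_of_contDiff [IsProbabilityMeasure P]
    (hF : ∀ ℓ, IsProbabilityMeasure (F ℓ))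
    (hint : ∀ ℓ, ∀ q ≤ 4 * h ℓ, Integrable (fun z : ℝ => z ^ q) (F ℓ))
    (hN : ∀ ℓ, Tendsto (fun m : ℕ => (N m ℓ : ℝ) / (m : ℝ)) atTop (𝓝 1))
    {ν : ℕ → Fin L → Measure ℝ} {Z : (m : ℕ) → (ℓ : Fin L) → Fin (N m ℓ) → Ω → ℝ}
    (hs : ∀ᶠ m in atTop, IsMomentSample P h (N m) (ν m) (Z m))
    (hlim : ∀ ℓ, ∀ q ≤ 4 * h ℓ,
      Tendsto (fun m => ∫ z, z ^ q ∂(ν m ℓ)) atTop (𝓝 (∫ z, z ^ q ∂(F ℓ))))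
    {g : MomentSpace h → ℝ} (hg : ContDiff ℝ 2 g) {B : ℝ} (hB : ∀ x, |g x| ≤ B) :
    Tendsto (fun m : ℕ => (m : ℝ) *
        Var[fun ω => g (sampleMoments h (N m) (fun ℓ j => Z m ℓ j ω)); P]) atTop
      (𝓝 (deltaVariance g (momentCov h F) (trueMoments h F))) := by
  have hx : Tendsto (fun m => trueMoments h (ν m)) atTop (𝓝 (trueMoments h F)) := by
    have := (PiLp.continuous_toLp 2 _).continuousAt.tendsto.comp
      (tendsto_pi_nhds.2 (tendsto_trueMoments hlim))
    exact this
  -- The expansion is around the moments of `ν m`, which move with m; one `K` serves all base points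
  -- near the limit.
  obtain ⟨K, hK⟩ := exists_abs_sub_sub_fderiv_le hg hB (trueMoments h F)
  rw [deltaVariance_eq_sum]
  refine tendsto_mul_variance_comp_sampleMoments hF hint hN hs hlim hg.continuous.measurable
    (a := fun m i => gradient g (trueMoments h (ν m)) i) (fun i => ?_) (K := K) ?_
  · exact ((PiLp.continuous_apply 2 _ i).comp (continuous_gradient hg)).continuousAt.tendsto.comp hx
  · filter_upwards [hx (Metric.ball_mem_nhds _ one_pos)] with m hm x
    have := hK _ hm x
    rwa [fderiv_eq_sum_gradient] at this

lemma IsInputData.isMomentSample {Z : Fin L → ℕ → Ω → ℝ} (hZ : IsInputData P F Z)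
    (hint : ∀ ℓ, ∀ q ≤ 4 * h ℓ, Integrable (fun z : ℝ => z ^ q) (F ℓ)) (n : Fin L → ℕ) :
    IsMomentSample P h n F (fun ℓ j => Z ℓ j) where
  measurable ℓ j := hZ.measurable ℓ j
  law ℓ j := hZ.law ℓ j
  indep := hZ.indep.precomp (g := fun p : (ℓ : Fin L) × Fin (n ℓ) => (p.1, (p.2 : ℕ))) (by
    rintro ⟨ℓ, j⟩ ⟨ℓ', j'⟩ hp
    obtain ⟨rfl, hj⟩ := Prod.mk.inj hp
    have : j = j' := Fin.ext hj
    rw [this])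
  integrable_pow := hint

end DeltaMethod

/-! ### Positive definiteness of the moment covariance. -/

section Covariance

variable {L : ℕ} {h : Fin L → ℕ} {F : Fin L → Measure ℝ}

lemma memLp_two_pow (hint : ∀ ℓ, ∀ q ≤ 4 * h ℓ, Integrable (fun z : ℝ => z ^ q) (F ℓ))
    [∀ ℓ, IsProbabilityMeasure (F ℓ)] (ℓ : Fin L) (a : Fin (h ℓ)) :
    MemLp (fun z : ℝ => z ^ (a.val + 1)) 2 (F ℓ) :=
  (memLp_four_of_integrable_pow (hint ℓ _ (by have := a.isLt; omega))).mono_exponent (by norm_num)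

/-- The block structure turns the quadratic form into variances of polynomials. This serves both
positive definiteness and the Gaussian characteristic function. -/
lemma dotProduct_momentCov_mulVec (hF : ∀ ℓ, IsProbabilityMeasure (F ℓ))
    (hint : ∀ ℓ, ∀ q ≤ 4 * h ℓ, Integrable (fun z : ℝ => z ^ q) (F ℓ)) (t : MomentIndex h → ℝ) :
    t ⬝ᵥ (momentCov h F *ᵥ t) =
      ∑ ℓ, Var[fun z => ∑ a : Fin (h ℓ), t ⟨ℓ, a⟩ * z ^ (a.val + 1); F ℓ] := by
  simp only [dotProduct, Matrix.mulVec]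
  rw [Fintype.sum_sigma]
  refine Finset.sum_congr rfl fun ℓ _ => ?_
  have hm := fun a => (memLp_two_pow hint ℓ a).const_mul (t ⟨ℓ, a⟩)
  rw [← covariance_self (memLp_finsetSum _ fun a _ => hm a).aemeasurable,
    covariance_fun_sum_fun_sum hm hm]
  refine Finset.sum_congr rfl fun a _ => ?_
  rw [Fintype.sum_sigma, Finset.sum_eq_single ℓ (fun ℓ' _ hl => by
    simp [momentCov, hl.symm]) (by simp), Finset.mul_sum]
  refine Finset.sum_congr rfl fun b _ => ?_
  rw [covariance_const_mul_left, covariance_const_mul_right]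
  simp only [momentCov, Matrix.of_apply, if_true]
  ring

lemma momentCov_isSymm (i j : MomentIndex h) : momentCov h F j i = momentCov h F i j := by
  obtain ⟨ℓ, a⟩ := i
  obtain ⟨ℓ', b⟩ := j
  by_cases hl : ℓ = ℓ'
  · subst hl
    simp only [momentCov, Matrix.of_apply, if_true]
    exact covariance_comm _ _
  · simp [momentCov, hl, Ne.symm hl]

open Polynomial in
/-- The covariance matrix of powers is positive definite unless a distribution is concentrated on
too few points. -/
theorem momentCov_posDef (hF : ∀ ℓ, IsProbabilityMeasure (F ℓ))
    (hint : ∀ ℓ, ∀ q ≤ 4 * h ℓ, Integrable (fun z : ℝ => z ^ q) (F ℓ))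
    (hnd : ∀ ℓ, ∀ S : Finset ℝ, S.card ≤ h ℓ → F ℓ (S : Set ℝ) ≠ 1) :
    (momentCov h F).PosDef := by
  refine Matrix.PosDef.of_dotProduct_mulVec_pos ?_ fun t ht => ?_
  · ext i j
    simp only [Matrix.conjTranspose_apply, star_trivial]
    exact momentCov_isSymm i j
  have e := dotProduct_momentCov_mulVec hF hint t
  rw [star_trivial]
  rw [e]
  refine (Finset.sum_nonneg fun ℓ _ => variance_nonneg _ _).lt_of_ne fun h0 => ht ?_
  rw [eq_comm, Finset.sum_eq_zero_iff_of_nonneg fun ℓ _ => variance_nonneg _ _] at h0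
  ext ⟨ℓ, a⟩
  by_contra hta
  have hm : MemLp (fun z : ℝ => ∑ a : Fin (h ℓ), t ⟨ℓ, a⟩ * z ^ (a.val + 1)) 2 (F ℓ) :=
    memLp_finsetSum _ fun a _ => (memLp_two_pow hint ℓ a).const_mul _
  have hae := ae_eq_integral_of_variance_eq_zero hm (h0 ℓ (Finset.mem_univ ℓ))
  set c := ∫ z, ∑ a : Fin (h ℓ), t ⟨ℓ, a⟩ * z ^ (a.val + 1) ∂(F ℓ)
  -- Zero variance makes `p` vanish almost surely. Subtracting `c` affects only the coefficient of
  -- degree 0, so a nonzero `t ⟨ℓ, a⟩` keeps `p ≠ 0`, and its at most `h ℓ` roots would carry `F ℓ`.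
  let p : ℝ[X] := ∑ a : Fin (h ℓ), C (t ⟨ℓ, a⟩) * X ^ (a.val + 1) - C c
  have hcoeff : p.coeff (a.val + 1) = t ⟨ℓ, a⟩ := by
    simp only [p, coeff_sub, finsetSum_coeff, coeff_C_mul, coeff_X_pow, coeff_C,
      Nat.succ_ne_zero, if_false, sub_zero]
    rw [Finset.sum_eq_single a (fun b _ hb => by
      rw [if_neg fun hab => hb (Fin.ext (by omega)), mul_zero]) (by simp)]
    simp
  have hp : p ≠ 0 := fun hp => hta (by rw [← hcoeff, hp]; simp)
  have hdeg : p.natDegree ≤ h ℓ := by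
    refine (natDegree_sub_le _ _).trans (max_le ?_ (by simp))
    exact natDegree_sum_le_of_forall_le _ _ fun b _ =>
      (natDegree_C_mul_X_pow_le _ _).trans b.isLt
  refine hnd ℓ p.roots.toFinset ((Multiset.toFinset_card_le _).trans ((card_roots' p).trans hdeg)) ?_
  rw [← mem_ae_iff_prob_eq_one (Finset.measurableSet _)]
  filter_upwards [hae] with z hz
  simp only [Finset.mem_coe, Multiset.mem_toFinset, mem_roots hp, IsRoot.def, p, eval_sub,
    eval_finsetSum, eval_mul, eval_C, eval_pow, eval_X]
  rw [hz, sub_self]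

end Covariance

/-! ### The central limit theorem for the sample moments. -/

section CentralLimit

/-- The usual scaling 1/√n differs from √m/n by √(m/n) → 1, which Slutsky's theorem absorbs. The
argument 1 is enough because the direction of the Cramér–Wold projection is put into `X`. -/
lemma tendsto_charFun_scaled_sum {Ω : Type*} [MeasurableSpace Ω] {P : Measure Ω}
    [IsProbabilityMeasure P] {X : ℕ → Ω → ℝ} (hX : MemLp (X 0) 2 P) (h0 : ∫ ω, X 0 ω ∂P = 0)
    (hindep : iIndepFun X P) (hident : ∀ i, IdentDistrib (X i) (X 0) P P) {n : ℕ → ℕ}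
    (hn : Tendsto (fun m : ℕ => (n m : ℝ) / (m : ℝ)) atTop (𝓝 1)) :
    Tendsto (fun m : ℕ => charFun
        (P.map fun ω => (√(m : ℝ) / (n m : ℝ)) * ∑ k ∈ Finset.range (n m), X k ω) 1) atTop
      (𝓝 (Complex.exp (-(Var[X 0; P] : ℂ) / 2))) := by
  have clt := tendstoInDistribution_inv_sqrt_mul_sum_sub
    (P' := gaussianReal 0 Var[X 0; P].toNNReal) (Y := id) ⟨by fun_prop, by simp⟩ hX hindep hident
  have sub : TendstoInDistribution (fun m ω => (√(n m : ℝ))⁻¹ *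
      (∑ k ∈ Finset.range (n m), X k ω - n m * P[X 0])) atTop id (fun _ => P)
      (gaussianReal 0 Var[X 0; P].toNNReal) :=
    ⟨fun m => clt.forall_aemeasurable (n m), clt.aemeasurable_limit,
      clt.tendsto.comp (tendsto_atTop_of_div_tendsto_one hn)⟩
  have hc : Tendsto (fun m : ℕ => √(m : ℝ) / √(n m : ℝ)) atTop (𝓝 1) := by
    have := (tendsto_mul_inv_of_div_tendsto_one hn).sqrt
    rw [Real.sqrt_one] at this
    exact this.congr fun m => Real.sqrt_div (Nat.cast_nonneg m) _
  have sl := sub.continuous_comp_prodMk_of_tendstoInMeasure_const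
    (g := fun p : ℝ × ℝ => p.2 * p.1) (by fun_prop)
    (tendstoInMeasure_of_tendsto_ae (fun m => aestronglyMeasurable_const)
      (ae_of_all P fun _ => hc)) (fun _ => aemeasurable_const)
  have key := ProbabilityMeasure.tendsto_iff_tendsto_charFun.1 sl.tendsto 1
  simp only [ProbabilityMeasure.coe_mk, one_mul, id, Measure.map_id', charFun_gaussianReal] at key
  convert key using 2 with m
  · congr 2
    ext ω
    rw [h0, mul_zero, sub_zero, ← mul_assoc, ← div_eq_mul_inv, div_div,
      Real.mul_self_sqrt (Nat.cast_nonneg _)]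
  · congr 1
    simp [Real.coe_toNNReal _ (variance_nonneg (X 0) P), neg_div]

/-- The central limit theorem for the vector of sample moments. -/
theorem tendstoInDistribution_momentEstimator {Ω : Type*} [MeasurableSpace Ω] {P : Measure Ω}
    [IsProbabilityMeasure P] {L : ℕ} {h : Fin L → ℕ} {F : Fin L → Measure ℝ}
    (hF : ∀ ℓ, IsProbabilityMeasure (F ℓ))
    (hint : ∀ ℓ, ∀ q ≤ 4 * h ℓ, Integrable (fun z : ℝ => z ^ q) (F ℓ))
    {Z : Fin L → ℕ → Ω → ℝ} (hZ : IsInputData P F Z) {N : ℕ → Fin L → ℕ}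
    (hN : ∀ ℓ, Tendsto (fun m : ℕ => (N m ℓ : ℝ) / (m : ℝ)) atTop (𝓝 1))
    (hΛ : (momentCov h F).PosSemidef) :
    TendstoInDistribution
      (fun (m : ℕ) ω => √(m : ℝ) • (momentEstimator h N Z m ω - trueMoments h F)) atTop
      (id : MomentSpace h → MomentSpace h) (fun _ => P)
      (multivariateGaussian (0 : MomentSpace h) (momentCov h F)) := by
  have hXm : ∀ m, Measurable (momentEstimator h N Z m) := fun m =>
    (hZ.isMomentSample hint (N m)).measurable_sampleMoments
  refine ⟨fun m => Measurable.aemeasurable (by have := hXm m; fun_prop), by fun_prop, ?_⟩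
  refine ProbabilityMeasure.tendsto_iff_tendsto_charFun.2 fun t => ?_
  simp only [ProbabilityMeasure.coe_mk, Measure.map_id]
  rw [charFun_multivariateGaussian hΛ, dotProduct_momentCov_mulVec hF hint]
  -- Pairing with `t` reduces each block to a centred scalar function of one observation.
  let f : Fin L → ℝ → ℝ := fun ℓ z =>
    ∑ a : Fin (h ℓ), t ⟨ℓ, a⟩ * (z ^ (a.val + 1) - trueMoments h F ⟨ℓ, a⟩)
  have hfm : ∀ ℓ, Measurable (f ℓ) := fun ℓ => by fun_prop
  have hf2 : ∀ ℓ, MemLp (f ℓ) 2 (F ℓ) := fun ℓ => memLp_finsetSum _ fun a _ =>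
    ((memLp_two_pow hint ℓ a).sub (memLp_const _)).const_mul _
  have hf0 : ∀ ℓ, ∫ z, f ℓ z ∂(F ℓ) = 0 := fun ℓ => by
    have hi : ∀ a : Fin (h ℓ), Integrable (fun z : ℝ => z ^ (a.val + 1)) (F ℓ) := fun a =>
      (memLp_two_pow hint ℓ a).integrable (by norm_num)
    have hj : ∀ a : Fin (h ℓ), Integrable
        (fun z : ℝ => t ⟨ℓ, a⟩ * (z ^ (a.val + 1) - trueMoments h F ⟨ℓ, a⟩)) (F ℓ) :=
      fun a => ((hi a).sub (integrable_const _)).const_mul _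
    rw [integral_finsetSum _ fun a _ => hj a]
    refine Finset.sum_eq_zero fun a _ => ?_
    rw [integral_const_mul, integral_sub (hi a) (integrable_const _)]
    simp [trueMoments]
  have hfv : ∀ ℓ, Var[f ℓ; F ℓ] =
      Var[fun z => ∑ a : Fin (h ℓ), t ⟨ℓ, a⟩ * z ^ (a.val + 1); F ℓ] := fun ℓ => by
    have : f ℓ = fun z => ∑ a : Fin (h ℓ), t ⟨ℓ, a⟩ * z ^ (a.val + 1) -
        ∑ a : Fin (h ℓ), t ⟨ℓ, a⟩ * trueMoments h F ⟨ℓ, a⟩ := by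
      ext z
      simp only [f, mul_sub, Finset.sum_sub_distrib]
    rw [this, variance_sub_const
      (memLp_finsetSum _ fun a _ => (memLp_two_pow hint ℓ a).const_mul _).aestronglyMeasurable]
  have map_f : ∀ ℓ j, P.map (fun ω => f ℓ (Z ℓ j ω)) = (F ℓ).map (f ℓ) := fun ℓ j => by
    rw [← hZ.law ℓ j, Measure.map_map (hfm ℓ) (hZ.measurable ℓ j)]
    rfl
  have one : ∀ ℓ, Tendsto (fun m : ℕ => charFun
        (P.map fun ω => (√(m : ℝ) / (N m ℓ : ℝ)) * ∑ k ∈ Finset.range (N m ℓ), f ℓ (Z ℓ k ω)) 1)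
      atTop (𝓝 (Complex.exp (-(Var[f ℓ; F ℓ] : ℂ) / 2))) := fun ℓ => by
    have hmZ := hZ.measurable ℓ 0
    have := tendsto_charFun_scaled_sum (P := P) (X := fun j ω => f ℓ (Z ℓ j ω)) (n := fun m => N m ℓ)
      (by
        have := hf2 ℓ
        rw [← hZ.law ℓ 0] at this
        exact this.comp_of_map hmZ.aemeasurable)
      (by
        rw [← hf0 ℓ, ← hZ.law ℓ 0, integral_map hmZ.aemeasurable (by fun_prop)])
      ((hZ.indep.precomp (g := fun j : ℕ => (ℓ, j)) (fun j j' hj => by simpa using hj)).comp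
        (fun _ => f ℓ) fun _ => hfm ℓ)
      (fun j => ⟨((hfm ℓ).comp (hZ.measurable ℓ j)).aemeasurable, ((hfm ℓ).comp hmZ).aemeasurable,
        by rw [map_f, map_f]⟩) (hN ℓ)
    have ev : Var[fun ω => f ℓ (Z ℓ 0 ω); P] = Var[f ℓ; F ℓ] := by
      rw [← hZ.law ℓ 0, variance_map (by fun_prop) hmZ.aemeasurable]
      rfl
    rwa [ev] at this
  have prod := tendsto_finsetProd (Finset.univ : Finset (Fin L)) fun ℓ _ => one ℓ
  rw [← Complex.exp_sum] at prod
  have hpos : ∀ᶠ m in atTop, ∀ ℓ, 0 < N m ℓ := eventually_all.2 fun ℓ =>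
    (tendsto_atTop_of_div_tendsto_one (hN ℓ)).eventually_gt_atTop 0
  have lim : ∑ ℓ, -(Var[f ℓ; F ℓ] : ℂ) / 2 = inner ℝ t (0 : MomentSpace h) * Complex.I -
      (∑ ℓ, Var[fun z => ∑ a : Fin (h ℓ), t ⟨ℓ, a⟩ * z ^ (a.val + 1); F ℓ] : ℝ) / 2 := by
    simp only [inner_zero_right, hfv]
    push_cast
    simp [neg_div, Finset.sum_div]
  rw [lim] at prod
  refine prod.congr' ?_
  filter_upwards [hpos] with m hm
  let Y : (p : (ℓ : Fin L) × Fin (N m ℓ)) → Ω → ℝ := fun p ω =>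
    (√(m : ℝ) / (N m p.1 : ℝ)) * f p.1 (Z p.1 p.2 ω)
  have hYm : ∀ p, Measurable (Y p) := fun p =>
    ((hfm p.1).comp (hZ.measurable p.1 p.2)).const_mul _
  have hYi : iIndepFun Y P := (hZ.isMomentSample hint (N m)).indep.comp
    (fun p z => (√(m : ℝ) / (N m p.1 : ℝ)) * f p.1 z) fun p => (hfm p.1).const_mul _
  have hXt : ∀ ω, inner ℝ (√(m : ℝ) • (momentEstimator h N Z m ω - trueMoments h F)) t =
      ∑ p, Y p ω := fun ω => by
    rw [PiLp.inner_apply, Fintype.sum_sigma, Fintype.sum_sigma]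
    refine Finset.sum_congr rfl fun ℓ _ => ?_
    have hn : (N m ℓ : ℝ) ≠ 0 := by exact_mod_cast (hm ℓ).ne'
    simp only [Y, f, ← Finset.mul_sum]
    change _ = √(m : ℝ) / (N m ℓ : ℝ) * ∑ j : Fin (N m ℓ), ∑ a : Fin (h ℓ),
      t ⟨ℓ, a⟩ * (Z ℓ j ω ^ (a.val + 1) - trueMoments h F ⟨ℓ, a⟩)
    rw [Finset.sum_comm, Finset.mul_sum]
    refine Finset.sum_congr rfl fun a _ => ?_
    rw [← Finset.mul_sum, Finset.sum_sub_distrib]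
    simp [momentEstimator, sampleMoments]
    field_simp
  have hW : Measurable fun ω => √(m : ℝ) • (momentEstimator h N Z m ω - trueMoments h F) := by
    have := hXm m
    fun_prop
  have e1 : charFun (P.map fun ω => √(m : ℝ) • (momentEstimator h N Z m ω - trueMoments h F)) t =
      charFun (P.map fun ω => ∑ p, Y p ω) 1 := by
    rw [charFun_apply, charFun_apply_real, integral_map hW.aemeasurable (by fun_prop),
      integral_map (Finset.measurable_sum _ fun p _ => hYm p).aemeasurable (by fun_prop)]
    simp only [hXt, Complex.ofReal_one, one_mul]
  -- Independence is used twice: the characteristic function is split over all observations, then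
  -- regrouped within each ℓ into the scalar sums treated in `one`.
  rw [e1, hYi.charFun_map_fun_sum_eq_prod fun p => (hYm p).aemeasurable, Finset.prod_apply,
    Fintype.prod_sigma]
  refine Finset.prod_congr rfl fun ℓ _ => ?_
  have hYl : iIndepFun (fun j : Fin (N m ℓ) => Y ⟨ℓ, j⟩) P :=
    hYi.precomp (g := fun j : Fin (N m ℓ) => (⟨ℓ, j⟩ : (ℓ : Fin L) × Fin (N m ℓ)))
      fun j j' hj => by simpa using hj
  rw [← Finset.prod_apply, ← hYl.charFun_map_fun_sum_eq_prod fun j => (hYm _).aemeasurable]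
  simp only [Y, Finset.mul_sum, Finset.sum_range]

end CentralLimit

/-! ### The kriging predictor: boundedness, smoothness, nonvanishing gradient. -/

section Kriging

variable {Ω : Type*} [MeasurableSpace Ω] {P : Measure Ω} {E : Type*} [NormedAddCommGroup E]

/-- Cauchy–Schwarz for `M u` and `M 0`. This is what bounds the predictor on the whole space. -/
lemma IsStationaryGP.abs_corr_le_one [IsProbabilityMeasure P] {β₀ τ2 : ℝ} {r : E → ℝ}
    {M : E → Ω → ℝ} (hM : IsStationaryGP P β₀ τ2 r M) (u : E) : |r u| ≤ 1 := by
  have hτ := hM.variance_pos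
  have hv : ∀ x, Var[M x; P] = τ2 := fun x => by
    rw [← covariance_self (hM.measurable x).aemeasurable, hM.covariance, sub_self, hM.corr_zero,
      mul_one]
  have := abs_covariance_le (hM.gaussian.hasGaussianLaw_eval u).memLp_two
    (hM.gaussian.hasGaussianLaw_eval 0).memLp_two
  rw [hM.covariance, hv, hv, sub_zero, Real.sqrt_mul_self hτ.le, abs_mul, abs_of_pos hτ] at this
  exact le_of_mul_le_mul_left (by linarith) hτ

section Linear

variable {k : ℕ} {V : Matrix (Fin k) (Fin k) ℝ}

/-- The kriging weights, contracted with `a`, are a linear functional of the observations. -/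
lemma dotProduct_mulVec_sub_glsMean (hV : V.PosDef) (a y : Fin k → ℝ) :
    a ⬝ᵥ (V⁻¹ *ᵥ fun i => y i - glsMean V y) =
      (V⁻¹ *ᵥ (a - (((1 : Fin k → ℝ) ⬝ᵥ (V⁻¹ *ᵥ 1))⁻¹ * (a ⬝ᵥ (V⁻¹ *ᵥ 1))) • 1)) ⬝ᵥ y := by
  have hsym : ∀ b z : Fin k → ℝ, b ⬝ᵥ (V⁻¹ *ᵥ z) = (V⁻¹ *ᵥ b) ⬝ᵥ z := fun b z => by
    have ht : V⁻¹ᵀ = V⁻¹ := by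
      have := hV.inv.isHermitian
      rwa [Matrix.IsHermitian, Matrix.conjTranspose_eq_transpose_of_trivial] at this
    rw [Matrix.dotProduct_mulVec, ← Matrix.mulVec_transpose, ht]
  have hy : (fun i => y i - glsMean V y) = y - glsMean V y • (1 : Fin k → ℝ) := by
    ext i; simp
  rw [hy, ← hsym]
  simp only [Matrix.mulVec_sub, Matrix.mulVec_smul, dotProduct_sub, dotProduct_smul,
    sub_dotProduct, smul_dotProduct, glsMean, smul_eq_mul]
  ring

/-- Estimating the mean projects out constant vectors; a nonconstant `a` survives because `V⁻¹` is
injective. -/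
lemma mulVec_sub_smul_one_ne_zero (hV : V.PosDef) {a : Fin k → ℝ} {i i' : Fin k} (ha : a i ≠ a i')
    (κ : ℝ) : V⁻¹ *ᵥ (a - κ • 1) ≠ 0 := fun h0 => by
  have hu : IsUnit V⁻¹ := hV.inv.isUnit
  have h1 : a - κ • (1 : Fin k → ℝ) = 0 :=
    Matrix.mulVec_injective_of_isUnit hu (by rw [h0, Matrix.mulVec_zero])
  have h2 : ∀ j, a j = κ := fun j => by
    have := congrFun h1 j
    simp at this
    linarith
  exact ha ((h2 i).trans (h2 i').symm)

end Linear

omit [MeasurableSpace Ω] in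
lemma measurable_generatedBy {ι : Type*} {β : ι → Type*} [∀ i, MeasurableSpace (β i)]
    (X : (i : ι) → Ω → β i) (i : ι) : Measurable[generatedBy X] (X i) :=
  (comap_measurable (X i)).mono (le_iSup (fun i => MeasurableSpace.comap (X i) inferInstance) i)
    le_rfl

/-- A nonzero linear functional of the sample means at the design points vanishes with probability
zero. -/
theorem ae_dotProduct_outputMeans_ne_zero [IsProbabilityMeasure P] {β₀ τ2 : ℝ} {r : E → ℝ}
    {M : E → Ω → ℝ} (hM : IsStationaryGP P β₀ τ2 r M) {s2 : E → ℝ≥0} {ε : ℕ → E → Ω → ℝ}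
    (hε : IsSimulationNoise P s2 ε)
    (hind : Indep (generatedBy M) (generatedBy fun p : ℕ × E => ε p.1 p.2) P)
    {k : ℕ} {x : Fin k → E} (hx : Function.Injective x) {n : Fin k → ℕ} (hn : ∀ i, 0 < n i)
    (hV : (designCov τ2 r s2 x n).PosDef) {c : Fin k → ℝ} (hc : c ≠ 0) :
    ∀ᵐ ω ∂P, c ⬝ᵥ outputMeans x n M ε ω ≠ 0 := by
  let U : Ω → ℝ := fun ω => ∑ i, c i * M (x i) ω
  let e : (i : Fin k) × Fin (n i) → Ω → ℝ := fun p ω => c p.1 / n p.1 * ε p.2 (x p.1) ω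
  let W : Ω → ℝ := fun ω => ∑ p, e p ω
  have hUW : ∀ ω, c ⬝ᵥ outputMeans x n M ε ω = U ω + W ω := fun ω => by
    simp only [dotProduct, outputMeans, U, W, e]
    rw [Fintype.sum_sigma, ← Finset.sum_add_distrib]
    refine Finset.sum_congr rfl fun i _ => ?_
    have hni : (n i : ℝ) ≠ 0 := by exact_mod_cast (hn i).ne'
    change _ = c i * M (x i) ω + ∑ j : Fin (n i), c i / n i * ε j (x i) ω
    rw [Finset.sum_add_distrib, ← Finset.mul_sum, Finset.sum_range (fun j => ε j (x i) ω)]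
    simp
    field_simp
  have hUg : HasGaussianLaw U P :=
    ((hM.gaussian.comp_right x).smul c).hasGaussianLaw_fun_sum (I := Finset.univ)
  have he : ∀ p, HasGaussianLaw (e p) P := fun p => by
    have : HasLaw (ε p.2 (x p.1)) (gaussianReal 0 (s2 (x p.1))) P :=
      ⟨(hε.measurable _ _).aemeasurable, hε.law _ _⟩
    exact this.hasGaussianLaw.fun_smul _
  have hei : iIndepFun e P := by
    -- Injectivity of `x` is essential: coinciding design points would share their noise variables.
    have h1 : iIndepFun (fun p : (i : Fin k) × Fin (n i) => ε p.2 (x p.1)) P :=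
      hε.indep.precomp (g := fun p : (i : Fin k) × Fin (n i) => ((p.2 : ℕ), x p.1)) (by
        rintro ⟨i, j⟩ ⟨i', j'⟩ hp
        obtain ⟨hj, hi⟩ := Prod.mk.inj hp
        obtain rfl := hx hi
        have : j = j' := Fin.ext hj
        rw [this])
    exact h1.comp (fun p z => c p.1 / n p.1 * z) fun p => by fun_prop
  have hWg : HasGaussianLaw W P := iIndepFun.hasGaussianLaw_fun_sum he hei
  have hUm : Measurable[generatedBy M] U := by
    refine Finset.measurable_sum _ fun i _ => ?_
    exact (measurable_generatedBy M (x i)).const_mul _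
  have hWm : Measurable[generatedBy fun p : ℕ × E => ε p.1 p.2] W := by
    refine Finset.measurable_sum _ fun p _ => ?_
    exact (measurable_generatedBy (fun p : ℕ × E => ε p.1 p.2) (p.2, x p.1)).const_mul _
  have hUWi : IndepFun U W P := (IndepFun_iff_Indep _ _ _).2 <|
    indep_of_indep_of_le_left (indep_of_indep_of_le_right hind hWm.comap_le) hUm.comap_le
  have hg : HasGaussianLaw (fun ω => U ω + W ω) P :=
    iIndepFun.hasGaussianLaw_fun_add hUg hWg hUWi
  have hUv : Var[U; P] = ∑ i, ∑ j, c i * (τ2 * r (x i - x j)) * c j := by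
    have h2 : ∀ i, MemLp (fun ω => c i * M (x i) ω) 2 P := fun i =>
      (hM.gaussian.hasGaussianLaw_eval (x i)).memLp_two.const_mul _
    rw [← covariance_self hUg.aemeasurable, covariance_fun_sum_fun_sum h2 h2]
    refine Finset.sum_congr rfl fun i _ => Finset.sum_congr rfl fun j _ => ?_
    rw [covariance_const_mul_left, covariance_const_mul_right, hM.covariance]
    ring
  have hWv : Var[W; P] = ∑ i, c i * ((s2 (x i) : ℝ) / n i) * c i := by
    have hev : ∀ p, Var[e p; P] = (c p.1 / n p.1) ^ 2 * s2 (x p.1) := fun p => by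
      simp only [e]
      rw [variance_const_mul, ← variance_id_map (hε.measurable _ _).aemeasurable, hε.law,
        variance_id_gaussianReal]
    have hWe : W = ∑ p, e p := by ext ω; simp [W]
    rw [hWe, IndepFun.variance_sum (fun p _ => (he p).memLp_two)
      (fun p _ q _ hpq => hei.indepFun hpq), Fintype.sum_sigma]
    refine Finset.sum_congr rfl fun i _ => ?_
    have hni : (n i : ℝ) ≠ 0 := by exact_mod_cast (hn i).ne'
    simp only [hev, Finset.sum_const, Finset.card_univ, Fintype.card_fin, nsmul_eq_mul]
    field_simp
  -- The variance is the quadratic form of Σ + C at `c`; being positive, it gives a Gaussian law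
  -- without atoms.
  have hpos : 0 < Var[fun ω => U ω + W ω; P] := by
    rw [hUWi.variance_fun_add hUg.memLp_two hWg.memLp_two, hUv, hWv]
    have := hV.dotProduct_mulVec_pos hc
    rw [star_trivial, designCov, Matrix.add_mulVec, dotProduct_add] at this
    simpa [dotProduct, Matrix.mulVec, Finset.mul_sum, Matrix.diagonal_apply, mul_assoc] using this
  have hnull : P.map (fun ω => U ω + W ω) {0} = 0 := by
    have := nullSingletonClass_gaussianReal (μ := P[fun ω => U ω + W ω])
      (v := Var[fun ω => U ω + W ω; P].toNNReal) (by simpa using hpos)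
    rw [hg.map_eq_gaussianReal]
    exact measure_singleton 0
  rw [Measure.map_apply_of_aemeasurable hg.aemeasurable (measurableSet_singleton 0)] at hnull
  rw [ae_iff]
  simp only [hUW, ne_eq, not_not]
  exact hnull

variable [NormedSpace ℝ E]

lemma contDiff_krigingMean {r : E → ℝ} (hr : ContDiff ℝ 2 r) (τ2 : ℝ) (s2 : E → ℝ≥0) {k : ℕ}
    (x : Fin k → E) (n : Fin k → ℕ) (y : Fin k → ℝ) : ContDiff ℝ 2 (krigingMean τ2 r s2 x n y) := by
  unfold krigingMean dotProduct
  refine contDiff_const.add (ContDiff.sum fun i _ => ContDiff.mul ?_ contDiff_const)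
  exact contDiff_const.mul (hr.comp (contDiff_id.sub contDiff_const))

omit [NormedSpace ℝ E] in
lemma exists_abs_krigingMean_le {r : E → ℝ} (hr : ∀ u, |r u| ≤ 1) (τ2 : ℝ) (s2 : E → ℝ≥0) {k : ℕ}
    (x : Fin k → E) (n : Fin k → ℕ) (y : Fin k → ℝ) :
    ∃ B, ∀ p, |krigingMean τ2 r s2 x n y p| ≤ B := by
  refine ⟨|glsMean (designCov τ2 r s2 x n) y| + ∑ i, |τ2| * |((designCov τ2 r s2 x n)⁻¹ *ᵥ
    fun i => y i - glsMean (designCov τ2 r s2 x n) y) i|, fun p => ?_⟩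
  unfold krigingMean dotProduct
  refine (abs_add_le _ _).trans (add_le_add le_rfl
    ((Finset.abs_sum_le_sum_abs _ _).trans (Finset.sum_le_sum fun i _ => ?_)))
  rw [abs_mul, abs_mul]
  exact mul_le_mul_of_nonneg_right (mul_le_of_le_one_right (abs_nonneg _) (hr _)) (abs_nonneg _)

lemma fderiv_krigingMean {r : E → ℝ} (hr : Differentiable ℝ r) (τ2 : ℝ) (s2 : E → ℝ≥0) {k : ℕ}
    (x : Fin k → E) (n : Fin k → ℕ) (y : Fin k → ℝ) (p v : E) :
    fderiv ℝ (krigingMean τ2 r s2 x n y) p v = τ2 * ((fun i => fderiv ℝ r (p - x i) v) ⬝ᵥ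
      ((designCov τ2 r s2 x n)⁻¹ *ᵥ fun i => y i - glsMean (designCov τ2 r s2 x n) y)) := by
  set w := (designCov τ2 r s2 x n)⁻¹ *ᵥ fun i => y i - glsMean (designCov τ2 r s2 x n) y with hw
  have h1 : ∀ i, HasFDerivAt (fun p => τ2 * r (p - x i) * w i)
      (w i • τ2 • fderiv ℝ r (p - x i)) p := fun i => by
    have h2 : HasFDerivAt (fun p => r (p - x i)) (fderiv ℝ r (p - x i)) p := by
      simpa [Function.comp_def] using (hr (p - x i)).hasFDerivAt.comp p ((hasFDerivAt_id p).sub_const (x i))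
    exact (h2.const_mul τ2).mul_const (w i)
  have h3 : HasFDerivAt (krigingMean τ2 r s2 x n y)
      (∑ i, w i • τ2 • fderiv ℝ r (p - x i)) p := by
    unfold krigingMean dotProduct
    exact (HasFDerivAt.fun_sum fun i _ => h1 i).const_add _
  rw [h3.fderiv]
  simp only [sum_apply, smul_apply, dotProduct,
    Finset.mul_sum, smul_eq_mul]
  exact Finset.sum_congr rfl fun i _ => by ring

end Kriging

/-- A quadratic form `∇gᵀ Λ ∇g` with positive definite `Λ` is positive where `g` has a nonzero
derivative. -/
lemma deltaVariance_pos {ι : Type*} [Fintype ι] {g : EuclideanSpace ℝ ι → ℝ} {Λ : Matrix ι ι ℝ}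
    (hΛ : Λ.PosDef) {x v : EuclideanSpace ℝ ι} (hv : fderiv ℝ g x v ≠ 0) :
    0 < deltaVariance g Λ x := by
  have h0 : (gradient g x).ofLp ≠ 0 := fun h0 => hv (by
    rw [fderiv_eq_sum_gradient]
    exact Finset.sum_eq_zero fun i _ => by rw [h0]; simp)
  have := hΛ.dotProduct_mulVec_pos h0
  rwa [star_trivial] at this

end InputUncertainty

theorem theorem3
    {Ω : Type*} [MeasurableSpace Ω] (P : Measure Ω) [IsProbabilityMeasure P]
    -- input distributions, their families, and the real-world data
    {L : ℕ} (h : Fin L → ℕ) (𝓕 : Fin L → Set (Measure ℝ)) (F : Fin L → Measure ℝ)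
    (hF : InputModel h 𝓕 F)
    (Z : Fin L → ℕ → Ω → ℝ) (hZ : IsInputData P F Z)
    -- no input distribution is concentrated on `h ℓ` or fewer points
    (hnd : ∀ ℓ, ∀ S : Finset ℝ, S.card ≤ h ℓ → F ℓ (S : Set ℝ) ≠ 1)
    -- sample sizes `m_ℓ = N m ℓ`, with `m_ℓ / m → 1`
    (N : ℕ → Fin L → ℕ)
    (hN : ∀ ℓ, Tendsto (fun m : ℕ => (N m ℓ : ℝ) / (m : ℝ)) atTop (𝓝 1))
    -- response surface and simulation noise
    (β₀ τ2 : ℝ) (r : MomentSpace h → ℝ) (M : MomentSpace h → Ω → ℝ)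
    (hM : IsStationaryGP P β₀ τ2 r M)
    (s2 : MomentSpace h → ℝ≥0) (ε : ℕ → MomentSpace h → Ω → ℝ) (hε : IsSimulationNoise P s2 ε)
    -- bootstrap
    (I : (m : ℕ) → ℕ → (ℓ : Fin L) → Fin (N m ℓ) → Ω → Fin (N m ℓ)) (hI : IsBootstrap P N I)
    -- data, noise, response surface and bootstrap are independent
    (hindep : iIndep
      ![generatedBy (fun p : Fin L × ℕ => Z p.1 p.2),
        generatedBy (fun p : ℕ × MomentSpace h => ε p.1 p.2),
        generatedBy M,
        generatedBy (fun p : (m : ℕ) × (ℕ × ((ℓ : Fin L) × Fin (N m ℓ))) =>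
          I p.1 p.2.1 p.2.2.1 p.2.2.2)] P)
    -- three derivatives of the correlation function, the third one bounded
    (hr : ∀ q < 3, Differentiable ℝ (iteratedFDeriv ℝ q r))
    (hr3 : ∃ K : ℝ, ∀ u, ‖iteratedFDeriv ℝ 3 r u‖ ≤ K)
    -- the experiment design
    {k : ℕ} (x : Fin k → MomentSpace h) (hx : Function.Injective x)
    (n : Fin k → ℕ) (hn : ∀ i, 0 < n i)
    (hV : (designCov τ2 r s2 x n).PosDef)
    (hgrad : ∃ i i', fderiv ℝ r (trueMoments h F - x i) ≠ fderiv ℝ r (trueMoments h F - x i')) :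
    -- the asymptotic covariance matrix of the moment estimators is positive definite
    (momentCov h F).PosDef ∧
    TendstoInDistribution
      (fun (m : ℕ) ω => √(m : ℝ) • (momentEstimator h N Z m ω - trueMoments h F)) atTop
      (id : MomentSpace h → MomentSpace h) (fun _ => P)
      (multivariateGaussian (0 : MomentSpace h) (momentCov h F)) ∧
    -- the two limits
    ∀ᵐ ω ∂P,
      0 < deltaVariance (krigingMean τ2 r s2 x n (outputMeans x n M ε ω)) (momentCov h F)
        (trueMoments h F) ∧
      Tendsto (fun m : ℕ => (m : ℝ) *
          inputVariance P (krigingMean τ2 r s2 x n (outputMeans x n M ε ω))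
            (momentEstimator h N Z m))
        atTop
        (𝓝 (deltaVariance (krigingMean τ2 r s2 x n (outputMeans x n M ε ω)) (momentCov h F)
          (trueMoments h F))) ∧
      ∃ v : ℕ → ℝ,
        (∀ m : ℕ, Tendsto (fun B : ℕ => (m : ℝ) *
            sampleVariance B (fun b => krigingMean τ2 r s2 x n (outputMeans x n M ε ω)
              (bootstrapMoments h N Z I m b ω)))
          atTop (𝓝 (v m))) ∧
        Tendsto v atTop
          (𝓝 (deltaVariance (krigingMean τ2 r s2 x n (outputMeans x n M ε ω)) (momentCov h F)
            (trueMoments h F))) := by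
  have hr2 : ContDiff ℝ 2 r := contDiff_of_differentiable_iteratedFDeriv (n := 2) fun q hq =>
    hr q (by have : q ≤ 2 := by exact_mod_cast hq
             omega)
  have hr1 : ∀ u, |r u| ≤ 1 := hM.abs_corr_le_one
  have hint := hF.integrable_pow
  have hΛ := momentCov_posDef hF.isProb hint hnd
  refine ⟨hΛ, tendstoInDistribution_momentEstimator hF.isProb hint hZ hN hΛ.posSemidef, ?_⟩
  obtain ⟨i, i', hii⟩ := hgrad
  obtain ⟨u, hu⟩ : ∃ u, fderiv ℝ r (trueMoments h F - x i) u ≠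
      fderiv ℝ r (trueMoments h F - x i') u := by
    by_contra! hu
    exact hii (ContinuousLinearMap.ext hu)
  -- Two different gradients are separated by some direction `u`, so this vector is not constant;
  -- the weights below express the derivative of the predictor along `u`, up to the factor `τ2`.
  let a : Fin k → ℝ := fun i => fderiv ℝ r (trueMoments h F - x i) u
  have hne := ae_dotProduct_outputMeans_ne_zero hM hε
    (hindep.indep (i := 2) (j := 1) (by decide)) hx hn hV
    (mulVec_sub_smul_one_ne_zero hV (a := a) hu
      (((1 : Fin k → ℝ) ⬝ᵥ ((designCov τ2 r s2 x n)⁻¹ *ᵥ 1))⁻¹ *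
        (a ⬝ᵥ ((designCov τ2 r s2 x n)⁻¹ *ᵥ 1))))
  filter_upwards [hne, hZ.ae_tendsto_moments hint, hI.ae_tendsto_sampleVariance]
    with ω hω hmom hboot
  set g := krigingMean τ2 r s2 x n (outputMeans x n M ε ω) with hg
  have hg2 : ContDiff ℝ 2 g := contDiff_krigingMean hr2 τ2 s2 x n _
  obtain ⟨B, hB⟩ := exists_abs_krigingMean_le hr1 τ2 s2 x n (outputMeans x n M ε ω)
  -- The inner limit is the exact bootstrap variance: data and outputs are frozen at `ω`, while only
  -- the draws vary with `ω'`. Resample 0 stands for all, as they have the same law.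
  refine ⟨deltaVariance_pos hΛ (v := u) ?_, ?_, fun m => m * Var[fun ω' => g (sampleMoments h (N m)
    fun ℓ j => Z ℓ (I m 0 ℓ j ω') ω); P], fun m => ?_, ?_⟩
  · rw [hg, fderiv_krigingMean (hr2.differentiable (by norm_num)),
      dotProduct_mulVec_sub_glsMean hV]
    exact mul_ne_zero hM.variance_pos.ne' hω
  · exact tendsto_mul_variance_of_contDiff hF.isProb hint hN (ν := fun _ => F)
      (Z := fun m ℓ j => Z ℓ j) (Eventually.of_forall fun m => hZ.isMomentSample hint (N m))
      (fun ℓ q _ => tendsto_const_nhds) hg2 hB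
  · exact (hboot m fun s => g (sampleMoments h (N m) fun ℓ j => Z ℓ (s ℓ j) ω)).const_mul (m : ℝ)
  · refine tendsto_mul_variance_of_contDiff hF.isProb hint hN
      (ν := fun m ℓ => empiricalMeasure fun j : Fin (N m ℓ) => Z ℓ j ω)
      (Z := fun m ℓ j ω' => Z ℓ (I m 0 ℓ j ω') ω)
      (Eventually.of_forall fun m => hI.isMomentSample h m 0 fun ℓ j => Z ℓ j ω)
      (fun ℓ q hq => ?_) hg2 hB
    simp only [integral_empiricalMeasure]
    exact (hmom ℓ q hq).comp (tendsto_atTop_of_div_tendsto_one (hN ℓ))
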